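/- Let $(R,\mathfrak m)$ be a complete local Noetherian normal Gorenstein domain of Krull dimension $3$, and let $\Lambda$ be a noncommutative crepant resolution (NCCR) of $R$: an $R$-algebra isomorphic to $\mathrm{End}_R(M)$ for some nonzero finitely generated reflexive $R$-module $M$, which is maximal Cohen–Macaulay as an $R$-module and has finite global dimension. For a ring $A$ let $\mathcal K^b(\mathrm{proj}\,A)$ be the homotopy category of bounded complexes of finitely generated projective $A$-modules. A complex $U\in\mathcal K^b(\mathrm{proj}\,A)$ is called - *2-term* if it is isomorphic in $\mathcal K^b(\mathrm{proj}\,A)$ to a complex concentrated in degrees $-1$ and $0$; - *basic* if it is a finite direct sum of pairwise non-isomorphic indecomposable objects of $\mathcal K^b(\mathrm{proj}\,A)$; - *silting* if $\mathrm{Hom}_{\mathcal K^b(\mathrm{proj}\,A)}(U,U[i])=0$ for all $i>0$ and the smallest triangulated subcategory of $\mathcal K^b(\mathrm{proj}\,A)$ that contains $U$ and is closed under direct summands is $\mathcal K^b(\mathrm{proj}\,A)$. Let $\mathrm{silt}\,A$ be the set of isomorphism classes of basic 2-term silting complexes, with the relation $U\le V$ if and only if $\mathrm{Hom}_{\mathcal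 K^b(\mathrm{proj}\,A)}(U,V[i])=0$ for all $i>0$. Then the functor $-\otimes_R R/\mathfrak m\colon \mathcal K^b(\mathrm{proj}\,\Lambda)\to\mathcal K^b(\mathrm{proj}\,\Lambda/\mathfrak m\Lambda)$ restricts to an order-preserving map $\mathrm{silt}\,\Lambda\to\mathrm{silt}\,\Lambda/\mathfrak m\Lambda$. That is, if $U$ is a basic 2-term silting complex over $\Lambda$, then $U\otimes_R R/\mathfrak m$ is a basic 2-term silting complex over $\Lambda/\mathfrak m\Lambda$; and if $U,V\in\mathrm{silt}\,\Lambda$ satisfy $U\le V$, then $U\otimes_R R/\mathfrak m\le V\otimes_R R/\mathfrak m$. -/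

import Mathlib

open CategoryTheory CategoryTheory.Limits

universe u

noncomputable section

namespace SiltingReduction

/-! ### The homotopy category of bounded complexes of finitely generated projectives -/

section HomotopyCategoryOfProjectives

variable (A : Type u) [Ring A]

/-- Finitely generated projective (left) `A`-modules. -/
def IsFGProj : ObjectProperty (ModuleCat.{u} A) :=
  fun P => Module.Finite A P ∧ Module.Projective A P

/-- A bounded cochain complex of finitely generated projective `A`-modules. -/
structure IsBoundedProj (C : CochainComplex (ModuleCat.{u} A) ℤ) : Prop where
  proj : ∀ i, IsFGProj A (C.X i)
  bounded : ∃ a b : ℤ, ∀ i, (i < a ∨ b < i) → IsZero (C.X i)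

/-- The objects of the homotopy category of `A`-modules which are bounded complexes of
finitely generated projectives. -/
def kbProj : ObjectProperty (HomotopyCategory (ModuleCat.{u} A) (ComplexShape.up ℤ)) :=
  fun X => IsBoundedProj A X.as

variable {A}

lemma IsFGProj.of_iso {P Q : ModuleCat.{u} A} (e : P ≅ Q) (h : IsFGProj A P) :
    IsFGProj A Q := by
  obtain ⟨h₁, h₂⟩ := h
  exact ⟨Module.Finite.equiv e.toLinearEquiv, Module.Projective.of_equiv e.toLinearEquiv⟩

lemma IsFGProj.of_isZero {P : ModuleCat.{u} A} (h : IsZero P) : IsFGProj A P := by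
  have hs : Subsingleton P := ModuleCat.subsingleton_of_isZero h
  exact ⟨Module.Finite.of_finite, Module.Projective.of_free⟩

lemma IsFGProj.biprod {P Q : ModuleCat.{u} A} (hP : IsFGProj A P) (hQ : IsFGProj A Q) :
    IsFGProj A (P ⊞ Q) := by
  obtain ⟨h₁, h₂⟩ := hP
  obtain ⟨h₃, h₄⟩ := hQ
  refine IsFGProj.of_iso (ModuleCat.biprodIsoProd P Q).symm ?_
  exact ⟨inferInstanceAs (Module.Finite A (P × Q)), inferInstanceAs (Module.Projective A (P × Q))⟩

open ZeroObject in
instance : (kbProj A).ContainsZero where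
  exists_zero :=
    ⟨(HomotopyCategory.quotient _ _).obj (0 : CochainComplex (ModuleCat.{u} A) ℤ),
      Functor.map_isZero _ (isZero_zero _),
      ⟨fun i => IsFGProj.of_isZero (Functor.map_isZero (HomologicalComplex.eval _ _ i)
        (isZero_zero _)),
       ⟨0, 0, fun i _ => Functor.map_isZero (HomologicalComplex.eval _ _ i) (isZero_zero _)⟩⟩⟩

instance : (kbProj A).IsStableUnderShift ℤ where
  isStableUnderShiftBy n :=
    { le_shift := by
        intro X hX
        obtain ⟨C, rfl⟩ := X.quotient_obj_surjective
        obtain ⟨h, a, b, hab⟩ := hX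
        rw [ObjectProperty.prop_shift_iff, HomotopyCategory.shift_quotient_obj]
        exact ⟨fun i => h (i + n), a - n, b - n, fun i hi => hab (i + n) (by lia)⟩ }

lemma IsBoundedProj.mappingCone {C D : CochainComplex (ModuleCat.{u} A) ℤ} (f : C ⟶ D)
    (hC : IsBoundedProj A C) (hD : IsBoundedProj A D) :
    IsBoundedProj A (CochainComplex.mappingCone f) := by
  obtain ⟨h₁, a₁, b₁, hab₁⟩ := hC
  obtain ⟨h₂, a₂, b₂, hab₂⟩ := hD
  refine ⟨fun i => ?_, min (a₁ - 1) a₂, max b₁ b₂, fun i hi => ?_⟩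
  · exact IsFGProj.of_iso
      (HomologicalComplex.homotopyCofiber.XIsoBiprod f i (i + 1) rfl).symm
      ((h₁ (i + 1)).biprod (h₂ i))
  · rw [CochainComplex.mappingCone.isZero_X_iff]
    exact ⟨hab₁ _ (by lia), hab₂ _ (by lia)⟩

set_option maxHeartbeats 400000 in
open Pretriangulated in
instance : (kbProj A).IsTriangulatedClosed₃ where
  ext₃' T hT h₁ h₂ := by
    obtain ⟨f, hf⟩ :=
      (HomotopyCategory.quotient (ModuleCat.{u} A) (ComplexShape.up ℤ)).map_surjective
      (X := T.obj₁.as) (Y := T.obj₂.as) T.mor₁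
    refine ⟨_, ?_,
      ⟨Triangle.π₃.mapIso (isoTriangleOfIso₁₂ T _ hT
        (HomotopyCategory.mappingCone_triangleh_distinguished f)
        (Iso.refl _) (Iso.refl _) ?_)⟩⟩
    · exact IsBoundedProj.mappingCone f h₁ h₂
    · refine (Category.comp_id _).trans (Eq.trans ?_ (Category.id_comp _).symm)
      exact hf.symm

instance : (kbProj A).IsTriangulated where
  toIsTriangulatedClosed₂ := .of_isTriangulatedClosed₃

variable (A)

/-- The triangulated category `K^b(proj A)`. -/
abbrev Kb := (kbProj A).FullSubcategory

end HomotopyCategoryOfProjectives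

/-! ### Silting complexes -/

section Silting

variable {A : Type u} [Ring A]

/-- `Hom(U, V[i]) = 0` in `K^b(proj A)` for all `i > 0`. -/
def HomVanishes (U V : Kb A) : Prop :=
  ∀ i : ℤ, 0 < i → ∀ f : U ⟶ (shiftFunctor (Kb A) i).obj V, f = 0

/-- `U` is, up to isomorphism in `K^b(proj A)`, concentrated in degrees `-1` and `0`. -/
def IsTwoTerm (U : Kb A) : Prop :=
  ∃ V : Kb A, Nonempty (U ≅ V) ∧ ∀ i : ℤ, i ≠ -1 → i ≠ 0 → IsZero (V.obj.as.X i)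

/-- `U` is a finite direct sum of pairwise non-isomorphic indecomposable objects. -/
def IsBasic (U : Kb A) : Prop :=
  ∃ (n : ℕ) (X : Fin n → Kb A),
    (∀ j, Indecomposable (X j)) ∧
    (∀ j k, Nonempty (X j ≅ X k) → j = k) ∧
    Nonempty (U ≅ ⨁ X)

/-- `U` is pre-silting, and the smallest triangulated subcategory of `K^b(proj A)` that
contains `U` and is closed under direct summands is all of `K^b(proj A)`. -/
structure IsSilting (U : Kb A) : Prop where
  preSilting : HomVanishes U U
  generates : (ObjectProperty.singleton U).IsClassicalTriangulatedGenerator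

variable (A)

/-- Isomorphism classes of objects of `K^b(proj A)`. -/
abbrev IsoClass := Quotient (isIsomorphicSetoid (Kb A))

variable {A}

/-- The isomorphism class of an object. -/
def isoClass (U : Kb A) : IsoClass A := Quotient.mk (isIsomorphicSetoid (Kb A)) U

variable (A)

/-- The set `silt A` of isomorphism classes of basic 2-term silting complexes. -/
def silt : Set (IsoClass A) :=
  {x | ∃ U : Kb A, IsBasic U ∧ IsTwoTerm U ∧ IsSilting U ∧ x = isoClass U}

variable {A}

lemma HomVanishes.of_iso {U V U' V' : Kb A} (e : U ≅ U') (e' : V ≅ V')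
    (h : HomVanishes U V) : HomVanishes U' V' := by
  intro i hi f
  have := h i hi (e.hom ≫ f ≫ (shiftFunctor (Kb A) i).map e'.inv)
  rw [← cancel_epi e.hom, ← cancel_mono ((shiftFunctor (Kb A) i).map e'.inv)]
  simpa using this

/-- The silting order: `[U] ≤ [V]` if and only if `Hom(U, V[i]) = 0` for all `i > 0`. -/
def siltLE (x y : IsoClass A) : Prop :=
  Quotient.liftOn₂ x y HomVanishes (fun _ _ _ _ ⟨e⟩ ⟨e'⟩ =>
    propext ⟨fun h => h.of_iso e e', fun h => h.of_iso e.symm e'.symm⟩)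

end Silting

/-! ### Noncommutative crepant resolutions -/

section NCCR

/-- A Noetherian local ring is Gorenstein if it has finite injective dimension over itself. -/
def IsGorensteinLocal (R : Type u) [CommRing R] [IsLocalRing R] [IsNoetherianRing R] : Prop :=
  ∃ n : ℕ, HasInjectiveDimensionLE (ModuleCat.of.{u} R R) n

/-- A maximal Cohen-Macaulay module over a local ring `R`: a finitely generated module that
admits a regular sequence in the maximal ideal of length `dim R`. -/
structure IsMaximalCohenMacaulay (R : Type u) [CommRing R] [IsLocalRing R]
    (M : Type u) [AddCommGroup M] [Module R M] : Prop where
  finite : Module.Finite R M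
  exists_regular : ∃ rs : List R, (∀ r ∈ rs, r ∈ IsLocalRing.maximalIdeal R) ∧
    RingTheory.Sequence.IsRegular M rs ∧ (rs.length : WithBot ℕ∞) = ringKrullDim R

/-- `A` has finite (left) global dimension. -/
def HasFiniteGlobalDimension (A : Type u) [Ring A] : Prop :=
  ∃ n : ℕ, ∀ N : ModuleCat.{u} A, HasProjectiveDimensionLE N n

/-- `Λ` is a noncommutative crepant resolution of the Gorenstein normal local domain `R`:
`Λ ≅ End_R(M)` for a nonzero finitely generated reflexive `R`-module `M`, and `Λ` is a maximal
Cohen-Macaulay `R`-module of finite global dimension. -/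
structure IsNCCR (R : Type u) [CommRing R] [IsLocalRing R]
    (Λ : Type u) [Ring Λ] [Algebra R Λ] : Prop where
  exists_reflexive : ∃ M : ModuleCat.{u} R, Module.Finite R M ∧ Module.IsReflexive R M ∧
    Nontrivial M ∧ Nonempty (Λ ≃ₐ[R] Module.End R M)
  maximalCohenMacaulay : IsMaximalCohenMacaulay R Λ
  finiteGlobalDimension : HasFiniteGlobalDimension Λ

end NCCR

/-! ### Reduction modulo the maximal ideal -/

section Reduction

variable (R : Type u) [CommRing R] [IsLocalRing R] (Λ : Type u) [Ring Λ] [Algebra R Λ]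

/-- The two-sided ideal `𝔪Λ` of `Λ`. -/
def fibreIdeal : Ideal Λ := (IsLocalRing.maximalIdeal R).map (algebraMap R Λ)

instance : (fibreIdeal R Λ).IsTwoSided := by
  constructor
  intro a b ha
  refine Submodule.span_induction (p := fun x _ => x * b ∈ fibreIdeal R Λ) ?_ ?_ ?_ ?_ ha
  · rintro _ ⟨r, hr, rfl⟩
    rw [Algebra.commutes]
    exact Ideal.mul_mem_left _ _ (Ideal.mem_map_of_mem _ hr)
  · simp
  · intro x y _ _ hx hy
    rw [add_mul]
    exact Ideal.add_mem _ hx hy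
  · intro c x _ hx
    rw [smul_eq_mul, mul_assoc]
    exact Ideal.mul_mem_left _ _ hx

/-- The fibre `Λ/𝔪Λ = Λ ⊗_R R/𝔪`. -/
abbrev Fibre := Λ ⧸ fibreIdeal R Λ

/-- The `Λ/𝔪Λ`-linear map `N/𝔪N → N'/𝔪N'` induced by `f : N → N'`. -/
def reduceMap {N N' : Type u} [AddCommGroup N] [Module Λ N] [AddCommGroup N'] [Module Λ N']
    (f : N →ₗ[Λ] N') :
    (N ⧸ fibreIdeal R Λ • (⊤ : Submodule Λ N)) →ₗ[Fibre R Λ]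
      (N' ⧸ fibreIdeal R Λ • (⊤ : Submodule Λ N')) where
  toFun := Submodule.mapQ _ _ f (by
    rw [← Submodule.map_le_iff_le_comap, Submodule.map_smul'']
    exact Submodule.smul_mono le_rfl le_top)
  map_add' := map_add _
  map_smul' := by
    intro a x
    obtain ⟨a, rfl⟩ := Ideal.Quotient.mk_surjective a
    obtain ⟨x, rfl⟩ := Submodule.Quotient.mk_surjective _ x
    exact congrArg (Submodule.Quotient.mk) (map_smul f a x)

/-- The functor `- ⊗_R R/𝔪` from `Λ`-modules to `Λ/𝔪Λ`-modules, in the form `N ↦ N/𝔪N`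
(note that `(𝔪Λ)N = 𝔪N`). -/
def reduceModule : ModuleCat.{u} Λ ⥤ ModuleCat.{u} (Fibre R Λ) where
  obj N := ModuleCat.of _ (N ⧸ fibreIdeal R Λ • (⊤ : Submodule Λ N))
  map f := ModuleCat.ofHom (reduceMap R Λ f.hom)
  map_id N := by
    refine ModuleCat.hom_ext (LinearMap.ext fun x => ?_)
    obtain ⟨x, rfl⟩ := Submodule.Quotient.mk_surjective _ x
    rfl
  map_comp f g := by
    refine ModuleCat.hom_ext (LinearMap.ext fun x => ?_)
    obtain ⟨x, rfl⟩ := Submodule.Quotient.mk_surjective _ x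
    rfl

instance : (reduceModule R Λ).Additive where
  map_add {N N' f g} := by
    refine ModuleCat.hom_ext (LinearMap.ext fun x => ?_)
    obtain ⟨x, rfl⟩ := Submodule.Quotient.mk_surjective _ x
    rfl

variable {Λ}

lemma IsFGProj.reduce {P : ModuleCat.{u} Λ} (h : IsFGProj Λ P) :
    IsFGProj (Fibre R Λ) ((reduceModule R Λ).obj P) := by
  obtain ⟨h₁, h₂⟩ := h
  let Q := P ⧸ fibreIdeal R Λ • (⊤ : Submodule Λ P)
  have : IsScalarTower Λ (Fibre R Λ) Q := by
    refine ⟨fun a b x => ?_⟩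
    obtain ⟨b, rfl⟩ := Ideal.Quotient.mk_surjective b
    obtain ⟨x, rfl⟩ := Submodule.Quotient.mk_surjective _ x
    exact congrArg Submodule.Quotient.mk (mul_smul a b x)
  refine ⟨Module.Finite.of_restrictScalars_finite Λ (Fibre R Λ) Q, ?_⟩
  change Module.Projective (Fibre R Λ) Q
  let π : (Q →₀ Fibre R Λ) →ₗ[Fibre R Λ] Q := Finsupp.linearCombination (Fibre R Λ) id
  have hπ : Function.Surjective π := Finsupp.linearCombination_id_surjective _ _
  obtain ⟨s, hs⟩ := Module.projective_lifting_property (π.restrictScalars Λ)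
    (Submodule.mkQ (fibreIdeal R Λ • (⊤ : Submodule Λ P))) hπ
  have hker : fibreIdeal R Λ • (⊤ : Submodule Λ P) ≤ LinearMap.ker s := by
    rw [Submodule.smul_le]
    intro a ha x _
    rw [LinearMap.mem_ker, map_smul]
    ext y
    rw [Finsupp.smul_apply, Finsupp.zero_apply]
    obtain ⟨b, hb⟩ := Ideal.Quotient.mk_surjective (s x y)
    rw [← hb]
    exact Ideal.Quotient.eq_zero_iff_mem.2 ((fibreIdeal R Λ).mul_mem_right b ha)
  let t : Q →ₗ[Fibre R Λ] (Q →₀ Fibre R Λ) :=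
    { toFun := Submodule.liftQ _ s hker
      map_add' := map_add _
      map_smul' := by
        intro a x
        obtain ⟨a, rfl⟩ := Ideal.Quotient.mk_surjective a
        obtain ⟨x, rfl⟩ := Submodule.Quotient.mk_surjective _ x
        exact map_smul s a x }
  refine ⟨t, ?_⟩
  intro x
  obtain ⟨x, rfl⟩ := Submodule.Quotient.mk_surjective _ x
  exact LinearMap.congr_fun hs x

variable (Λ)

/-- The functor `- ⊗_R R/𝔪 : K^b(proj Λ) ⥤ K^b(proj Λ/𝔪Λ)`. -/
def reduction : Kb Λ ⥤ Kb (Fibre R Λ) :=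
  (kbProj (Fibre R Λ)).lift
    ((kbProj Λ).ι ⋙ (reduceModule R Λ).mapHomotopyCategory (ComplexShape.up ℤ)) (by
      rintro ⟨X, hX⟩
      obtain ⟨C, rfl⟩ := X.quotient_obj_surjective
      obtain ⟨h, a, b, hab⟩ := hX
      exact ⟨fun i => (h i).reduce R, a, b,
        fun i hi => Functor.map_isZero (reduceModule R Λ) (hab i hi)⟩)

/-- The map induced by `- ⊗_R R/𝔪` on isomorphism classes. -/
def reductionClass : IsoClass Λ → IsoClass (Fibre R Λ) :=
  Quotient.map (reduction R Λ).obj (fun _ _ ⟨e⟩ => ⟨(reduction R Λ).mapIso e⟩)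

end Reduction

end SiltingReduction

end

/-! Write `F` for reduction modulo `𝔪`. The proof rests on the two-term shape, on completeness of
the Noetherian local ring `R`, and on finiteness of `Λ` as an `R`-module.

Between complexes in degrees `-1` and `0` there are no cochains of degree at least 2. So `Hom(C,
D[i]) = 0` for all `i > 0` says exactly that `δ` from 0-cochains to 1-cochains is surjective
(`homVanishes_kbOf_iff_of_isConcentrated`). Cochains lift along `F` because the terms are
projective, so this surjectivity descends to the fibre. That gives the order statement and the
pre-silting condition.

The same surjectivity makes `Hom(C, D) → Hom(FC, FD)` surjective
(`exists_reduction_map_eq_of_homVanishes`): the failure of a lift to be a chain map is a 1-cochain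
in `𝔪`, and it is corrected by a 0-cochain in `𝔪`. With Nakayama in the homotopy category
(`isIso_of_reduction_map_eq_id`), isomorphisms between reductions lift, so non-isomorphic summands
stay non-isomorphic.

Indecomposability survives because an indecomposable object of `K^b(proj Λ)` has a local
endomorphism ring, and the surjection onto the endomorphism ring of its reduction preserves this.
Locality comes from `exists_fitting_idempotent`, which produces strict idempotents among chain
endomorphisms; these split already in complexes. The same device shows that summands of two-term
objects are two-term.

Generation passes to the fibre since finitely generated projectives over `Λ/𝔪Λ` are retracts of
reductions of free `Λ`-modules (`isClassicalTriangulatedGenerator_reduction`). -/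

noncomputable section

namespace SiltingReduction

/-! ### Fitting idempotents in finite algebras over a complete local ring -/

section FittingIdempotent

open IsLocalRing

/-- A finite module over a complete ring is precomplete. -/
lemma isPrecomplete_of_finite {R : Type*} [CommRing R] (I : Ideal R) [IsAdicComplete I R]
    (M : Type*) [AddCommGroup M] [Module R M] [Module.Finite R M] : IsPrecomplete I M := by
  rw [← AdicCompletion.of_surjective_iff]
  intro x
  obtain ⟨t, rfl⟩ := AdicCompletion.ofTensorProduct_surjective_of_finite I M x
  induction t with
  | zero => exact ⟨0, by simp⟩
  | add s t hs ht =>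
    obtain ⟨y, hy⟩ := hs
    obtain ⟨z, hz⟩ := ht
    exact ⟨y + z, by rw [map_add, map_add, hy, hz]⟩
  | tmul r m =>
    obtain ⟨r, rfl⟩ := AdicCompletion.of_surjective I R r
    refine ⟨r • m, ?_⟩
    rw [AdicCompletion.ofTensorProduct_tmul]
    ext n
    rw [map_smul]
    rfl

variable {R : Type*} [CommRing R] [IsLocalRing R] [IsNoetherianRing R]
  [IsAdicComplete (maximalIdeal R) R]

/-- A commutative finite algebra over a complete Noetherian local ring is complete for the
extension of the maximal ideal. -/
lemma isAdicComplete_map_of_finite (S : Type*) [CommRing S] [Algebra R S] [Module.Finite R S] :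
    IsAdicComplete ((maximalIdeal R).map (algebraMap R S)) S := by
  have hp := isPrecomplete_of_finite (maximalIdeal R) S
  have hh : IsHausdorff (maximalIdeal R) S := inferInstance
  have key : ∀ n : ℕ, ∀ x y : S, x ≡ y [SMOD ((maximalIdeal R).map (algebraMap R S)) ^ n •
      (⊤ : Submodule S S)] ↔ x ≡ y [SMOD (maximalIdeal R) ^ n • (⊤ : Submodule R S)] := by
    intro n x y
    rw [SModEq.sub_mem, SModEq.sub_mem, ← Ideal.map_pow, smul_eq_mul, Ideal.mul_top,
      Ideal.smul_top_eq_map]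
    rfl
  exact
    { haus' := fun x hx => hh.haus' x fun n => (key n x 0).1 (hx n)
      prec' := fun f hf => by
        obtain ⟨L, hL⟩ := hp.prec' f fun h => (key _ _ _).1 (hf h)
        exact ⟨L, fun n => (key _ _ _).2 (hL n)⟩ }

/-- In the Artinian ring `S/𝔪S` the powers of `a` stabilise, which yields an idempotent multiple of
`a` fixing a power of `a`. Hensel's lemma lifts it to `S`. The two congruences persist modulo the
Jacobson radical because completeness places `𝔪S` inside it. -/
lemma exists_fitting_idempotent_of_commRing (S : Type*) [CommRing S] [Algebra R S]
    [Module.Finite R S] (a : S) :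
    ∃ (e c : S) (n : ℕ), IsIdempotentElem e ∧ e - a * c ∈ (⊥ : Ideal S).jacobson ∧
      a ^ n - a ^ n * e ∈ (⊥ : Ideal S).jacobson := by
  set I := (maximalIdeal R).map (algebraMap R S) with hI
  have := isAdicComplete_map_of_finite (R := R) S
  have hJ : I ≤ (⊥ : Ideal S).jacobson := IsAdicComplete.le_jacobson_bot I
  have : Module.Finite (R ⧸ maximalIdeal R) (S ⧸ I) :=
    Module.Finite.of_restrictScalars_finite R _ _
  let := Ideal.Quotient.field (maximalIdeal R)
  have : IsArtinianRing (S ⧸ I) := IsArtinianRing.of_finite (R ⧸ maximalIdeal R) (S ⧸ I)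
  obtain ⟨n, y, hy⟩ := IsArtinian.exists_pow_succ_smul_dvd (Ideal.Quotient.mk I a) (1 : S ⧸ I)
  obtain ⟨y, rfl⟩ := Ideal.Quotient.mk_surjective y
  set q := Ideal.Quotient.mk I with hq
  simp only [smul_eq_mul, mul_one, Nat.succ_eq_add_one] at hy
  have h1 : ∀ k, q a ^ (n + 1) * (q a * q y) ^ k = q a ^ (n + 1) := by
    intro k
    induction k with
    | zero => simp
    | succ k ih =>
      rw [pow_succ (q a * q y), ← mul_assoc, ih]
      linear_combination q a * hy
  have he0 : IsIdempotentElem (q ((a * y) ^ (n + 1))) := by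
    rw [IsIdempotentElem, map_pow, map_mul]
    calc _ = (q a ^ (n + 1) * (q a * q y) ^ (n + 1)) * q y ^ (n + 1) := by ring
      _ = _ := by rw [h1]; ring
  -- The exponent `n + 1` rather than `n` makes `e₀` a visible multiple of `a`, which provides the
  -- cofactor `c = (a * y) ^ n * y`.
  set e₀ := (a * y) ^ (n + 1) with he
  have hmem : e₀ * e₀ - e₀ ∈ I := by
    rw [← Ideal.Quotient.eq, map_mul]; exact he0
  -- The derivative `2 * e₀ - 1` is its own inverse modulo `I`, as its square is `1 + 4 * (e₀ * e₀ -
  -- e₀)`.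
  obtain ⟨e, hroot, hee⟩ := HenselianRing.is_henselian (R := S) (I := I)
    (Polynomial.X ^ 2 - Polynomial.X) (by monicity!) e₀ (by simpa [sq] using hmem) (by
      rw [isUnit_iff_exists_inv]
      refine ⟨q (2 * e₀ - 1), ?_⟩
      rw [← map_mul, ← map_one q, Ideal.Quotient.eq]
      have := I.mul_mem_left 4 hmem
      convert this using 1
      simp
      ring)
  have he2 : IsIdempotentElem e := by
    have : e ^ 2 - e = 0 := by simpa [Polynomial.IsRoot] using hroot
    rw [IsIdempotentElem]; linear_combination this
  refine ⟨e, (a * y) ^ n * y, n + 1, he2, hJ ?_, hJ ?_⟩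
  · convert hee using 1
    rw [he]; ring
  · have : q e = q e₀ := by rw [Ideal.Quotient.eq]; exact hee
    rw [← Ideal.Quotient.eq]
    simp only [map_mul, map_pow]
    change q a ^ (n + 1) = q a ^ (n + 1) * q e
    rw [this, he, map_pow, map_mul, h1]

/-- An element `a` of a finite algebra over a complete Noetherian local ring has a Fitting
idempotent `e`: in every image where `e` is trivial, one of `a` and `1 - a` is a unit, and
`e` agrees with `a` in every image where `a` is idempotent. -/
theorem exists_fitting_idempotent (R : Type*) [CommRing R] [IsLocalRing R] [IsNoetherianRing R]
    [IsAdicComplete (maximalIdeal R) R] {Z E : Type*} [Ring Z] [Algebra R Z] [Module.Finite R Z]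
    [Ring E] (π : Z →+* E) (a : Z) :
    ∃ e : Z, IsIdempotentElem e ∧ (π e = 1 → IsUnit (π a)) ∧ (π e = 0 → IsUnit (π (1 - a))) ∧
      (IsIdempotentElem (π a) → π e = π a) := by
  have : IsMulCommutative (Algebra.adjoin R {a}) := Algebra.isMulCommutative_adjoin R (by simp)
  have : IsNoetherian R Z := isNoetherian_of_isNoetherianRing_of_finite R Z
  have : Module.Finite R (Algebra.adjoin R {a}) :=
    inferInstanceAs (Module.Finite R (Subalgebra.toSubmodule (Algebra.adjoin R {a})))
  let φ : Algebra.adjoin R {a} →+* E := π.comp (Algebra.adjoin R {a}).val.toRingHom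
  let b : Algebra.adjoin R {a} := ⟨a, Algebra.self_mem_adjoin_singleton R a⟩
  obtain ⟨e, c, n, he, h1, h2⟩ := exists_fitting_idempotent_of_commRing (R := R) _ b
  have hu : ∀ x ∈ (⊥ : Ideal (Algebra.adjoin R {a})).jacobson, IsUnit (φ (1 - x)) := fun x hx =>
    IsUnit.map φ (by
      have := Ideal.mem_jacobson_bot.1 hx (-1)
      convert this using 1
      ring)
  -- An idempotent of `E` that is the image of a radical element vanishes, since its complement is a
  -- unit.
  have hkill : ∀ f x : Algebra.adjoin R {a}, x ∈ (⊥ : Ideal (Algebra.adjoin R {a})).jacobson →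
      IsIdempotentElem (φ f) → φ f = φ x → φ f = 0 := by
    intro f x hx hf hfx
    have := hu x hx
    rw [map_sub, ← hfx, map_one] at this
    have h0 : (1 - φ f) * φ f = 0 := by rw [sub_mul, one_mul, hf.eq, sub_self]
    exact (this.mul_right_eq_zero).1 h0
  refine ⟨e, congrArg Subtype.val he, fun h => ?_, fun h => ?_, fun h => ?_⟩
  · have h' : φ e = 1 := h
    have := hu _ h1
    rw [show 1 - (e - b * c) = (1 - e) + b * c by ring, map_add, map_sub, map_one, h', sub_self,
      zero_add] at this
    have hc : Commute (φ b) (φ c) := by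
      rw [Commute, SemiconjBy, ← map_mul, ← map_mul, mul_comm]
    rw [map_mul, hc.isUnit_mul_iff] at this
    exact this.1
  · have h' : φ e = 0 := h
    have := hu _ h2
    have h3 : φ (1 - (b ^ n - b ^ n * e)) = φ (1 - b ^ n) := by
      simp only [map_sub, map_mul, h', mul_zero, sub_zero]
    obtain ⟨d, hd⟩ := sub_dvd_pow_sub_pow (1 : Algebra.adjoin R {a}) b n
    rw [one_pow] at hd
    have hc : Commute (φ (1 - b)) (φ d) := by
      rw [Commute, SemiconjBy, ← map_mul, ← map_mul, mul_comm]
    rw [h3, hd, map_mul, hc.isUnit_mul_iff] at this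
    exact this.1
  · change φ e = φ b
    have hb : IsIdempotentElem (φ b) := h
    have he' : IsIdempotentElem (φ e) := he.map φ
    have hc : φ b * φ e = φ e * φ b := by rw [← map_mul, ← map_mul, mul_comm]
    have hbe : Commute (φ b) (φ e) := hc
    have hbn : ∀ k, φ b ^ (k + 1) = φ b := fun k => hb.pow_succ_eq k
    -- When `φ b` is idempotent, `φ ((1 - b) * b) = 0`, so `(1 - b) * e` has the same image as a
    -- radical element. The same holds for `b * (1 - e)` below, because `φ b` equals its positive
    -- powers.
    have e1 : φ ((1 - b) * e) = 0 := by
      refine hkill _ ((1 - b) * (e - b * c)) (Ideal.mul_mem_left _ _ h1) ?_ ?_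
      · rw [map_mul, map_sub, map_one]
        exact (hb.one_sub).mul_of_commute ((Commute.one_left _).sub_left hbe) he'
      · rw [← sub_eq_zero, ← map_sub, show (1 - b) * e - (1 - b) * (e - b * c) = (b - b * b) * c by
          ring, map_mul, map_sub, map_mul, hb.eq, sub_self, zero_mul]
    have e2 : φ (b * (1 - e)) = 0 := by
      refine hkill _ (b * (b ^ n - b ^ n * e)) (Ideal.mul_mem_left _ _ h2) ?_ ?_
      · rw [map_mul, map_sub, map_one]
        exact hb.mul_of_commute ((Commute.one_right _).sub_right hbe) he'.one_sub
      · rw [show b * (b ^ n - b ^ n * e) = b ^ (n + 1) * (1 - e) by ring, map_mul, map_mul, map_pow,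
          hbn]
    have : φ e - φ b = φ ((1 - b) * e) - φ (b * (1 - e)) := by
      rw [← map_sub, ← map_sub]
      congr 1
      ring
    rw [e1, e2, sub_zero] at this
    exact sub_eq_zero.1 this

end FittingIdempotent

/-! ### Hom vanishing as a condition on cochains -/

section HomVanishing

open CochainComplex.HomComplex

variable {A : Type u} [Ring A]

/-- The object of `K^b(proj A)` given by a bounded complex of finitely generated projectives. -/
abbrev kbOf (C : CochainComplex (ModuleCat.{u} A) ℤ) (hC : IsBoundedProj A C) : Kb A :=
  ⟨(HomotopyCategory.quotient _ _).obj C, hC⟩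

/-- The morphism in `K^b(proj A)` given by a morphism of complexes. -/
abbrev kbMap {C D : CochainComplex (ModuleCat.{u} A) ℤ} (hC : IsBoundedProj A C)
    (hD : IsBoundedProj A D) (f : C ⟶ D) : kbOf C hC ⟶ kbOf D hD :=
  ObjectProperty.homMk ((HomotopyCategory.quotient _ _).map f)

lemma kbMap_surjective {C D : CochainComplex (ModuleCat.{u} A) ℤ} (hC : IsBoundedProj A C)
    (hD : IsBoundedProj A D) (f : kbOf C hC ⟶ kbOf D hD) : ∃ g, kbMap hC hD g = f := by
  obtain ⟨g, hg⟩ := (HomotopyCategory.quotient _ _).map_surjective f.hom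
  exact ⟨g, ObjectProperty.hom_ext _ hg⟩

lemma forall_hom_eq_zero_iff_of_iso {𝒞 : Type*} [Category 𝒞] [HasZeroMorphisms 𝒞]
    {X Y Y' : 𝒞} (e : Y ≅ Y') : (∀ f : X ⟶ Y, f = 0) ↔ ∀ f : X ⟶ Y', f = 0 := by
  constructor
  · intro h f
    rw [← cancel_mono e.inv, h (f ≫ e.inv), zero_comp]
  · intro h f
    rw [← cancel_mono e.hom, h (f ≫ e.hom), zero_comp]

lemma homVanishes_iff (U V : Kb A) : HomVanishes U V ↔
    ∀ i : ℤ, 0 < i → ∀ f : U.obj ⟶ (shiftFunctor _ i).obj V.obj, f = 0 := by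
  refine forall₂_congr fun i _ => ?_
  refine Iff.trans ?_ (forall_hom_eq_zero_iff_of_iso (((kbProj A).ι.commShiftIso i).app V))
  constructor
  · intro h f
    have := congrArg (kbProj A).ι.map (h ((kbProj A).fullyFaithfulι.preimage (X := U)
      (Y := (shiftFunctor (Kb A) i).obj V) f))
    rwa [Functor.FullyFaithful.map_preimage, Functor.map_zero] at this
  · intro h f
    apply (kbProj A).ι.map_injective
    rw [Functor.map_zero]
    exact h _

/-- Morphisms `C ⟶ D[n + 1]` up to homotopy are classes of degree `n + 1` in the Hom complex, so
vanishing says that every cocycle is a coboundary. -/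
lemma homVanishes_kbOf_iff {C D : CochainComplex (ModuleCat.{u} A) ℤ}
    (hC : IsBoundedProj A C) (hD : IsBoundedProj A D) :
    HomVanishes (kbOf C hC) (kbOf D hD) ↔
      ∀ n : ℤ, 0 ≤ n → ∀ z : Cocycle C D (n + 1), ∃ y : Cochain C D n, δ n (n + 1) y = z := by
  have key : HomVanishes (kbOf C hC) (kbOf D hD) ↔ ∀ i : ℤ, 0 < i →
      ∀ f : (HomotopyCategory.quotient _ _).obj C ⟶ (HomotopyCategory.quotient _ _).obj (D⟦i⟧),
        f = 0 := by
    rw [homVanishes_iff]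
    refine forall₂_congr fun i _ => Iff.symm ?_
    exact forall_hom_eq_zero_iff_of_iso
      (((HomotopyCategory.quotient (ModuleCat.{u} A) (ComplexShape.up ℤ)).commShiftIso i).app D)
  rw [key]
  constructor
  · intro h n hn z
    rw [← mem_coboundaries_iff _ n rfl, ← CohomologyClass.toHom_mk_eq_zero_iff]
    exact h (n + 1) (by lia) _
  · intro h i hi f
    obtain ⟨n, rfl⟩ : ∃ n, i = n + 1 := ⟨i - 1, by lia⟩
    obtain ⟨x, hx⟩ := (CohomologyClass.toHom_bijective C D (n + 1)).2 f
    obtain ⟨z, rfl⟩ := x.mk_surjective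
    rw [← hx]
    refine (CohomologyClass.toHom_mk_eq_zero_iff _).2 ?_
    rw [mem_coboundaries_iff _ n rfl]
    exact h n (by lia) z

lemma cochain_sum_v {C D : CochainComplex (ModuleCat.{u} A) ℤ} {n : ℤ} {k : ℕ}
    (w : Fin k → Cochain C D n) (p q : ℤ) (hpq : p + n = q) :
    (∑ i, w i).v p q hpq = ∑ i, (w i).v p q hpq :=
  map_sum (AddMonoidHom.mk' (fun z : Cochain C D n => z.v p q hpq)
    fun z z' => Cochain.add_v z z' p q hpq) w Finset.univ

/-- A complex concentrated in degrees `-1` and `0`. -/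
def IsConcentrated (C : CochainComplex (ModuleCat.{u} A) ℤ) : Prop :=
  ∀ i : ℤ, i ≠ -1 → i ≠ 0 → IsZero (C.X i)

lemma IsConcentrated.cochain_eq_zero {C D : CochainComplex (ModuleCat.{u} A) ℤ}
    (hC : IsConcentrated C) (hD : IsConcentrated D) {n : ℤ} (hn : 2 ≤ n) (z : Cochain C D n) :
    z = 0 := by
  ext p q hpq : 1
  by_cases h : p = -1 ∨ p = 0
  · exact (hD q (by lia) (by lia)).eq_of_tgt _ _
  · exact (hC p (by lia) (by lia)).eq_of_src _ _

/-- Every 1-cochain is a cocycle, since its differential lies in degree 2, and higher degrees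
contribute nothing. The cocycle condition thus disappears, leaving a pure surjectivity statement,
which is what descends along reduction. -/
lemma homVanishes_kbOf_iff_of_isConcentrated {C D : CochainComplex (ModuleCat.{u} A) ℤ}
    (hC : IsBoundedProj A C) (hD : IsBoundedProj A D) (hC' : IsConcentrated C)
    (hD' : IsConcentrated D) :
    HomVanishes (kbOf C hC) (kbOf D hD) ↔
      ∀ z : Cochain C D 1, ∃ y : Cochain C D 0, δ 0 1 y = z := by
  rw [homVanishes_kbOf_iff]
  constructor
  · intro h z
    exact h 0 le_rfl (Cocycle.mk z 2 rfl (hC'.cochain_eq_zero hD' le_rfl _))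
  · intro h n hn z
    rcases hn.eq_or_lt with rfl | hn
    · exact h z.1
    · exact ⟨0, by rw [δ_zero, hC'.cochain_eq_zero hD' (by lia) (z : Cochain C D (n + 1))]⟩

end HomVanishing

/-! ### The action of `R` on complexes of `Λ`-modules -/

section Scalars

variable {R : Type u} [CommRing R] {Λ : Type u} [Ring Λ] [Algebra R Λ]

/-- Multiplication by an element of `R` on a `Λ`-module. -/
def scalarEnd (r : R) (N : ModuleCat.{u} Λ) : N ⟶ N :=
  ModuleCat.ofHom
    { toFun := fun x => algebraMap R Λ r • x
      map_add' := smul_add _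
      map_smul' := fun a x => by
        simp only [RingHom.id_apply, ← mul_smul, Algebra.commutes] }

lemma scalarEnd_naturality (r : R) {N N' : ModuleCat.{u} Λ} (f : N ⟶ N') :
    f ≫ scalarEnd r N' = scalarEnd r N ≫ f := by
  ext x
  exact (map_smul f.hom _ x).symm

/-- Multiplication by an element of `R` on a complex of `Λ`-modules. -/
@[simps]
def scalarChain (r : R) (C : CochainComplex (ModuleCat.{u} Λ) ℤ) : C ⟶ C where
  f i := scalarEnd r (C.X i)
  comm' _ _ _ := (scalarEnd_naturality r _).symm

end Scalars

/-! ### Lifting cochains and morphisms from the fibre -/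

section Lifting

open CochainComplex.HomComplex

variable (R : Type u) [CommRing R] [IsLocalRing R] (Λ : Type u) [Ring Λ] [Algebra R Λ]

instance : (reduction R Λ).CommShift ℤ := by unfold reduction; infer_instance

instance : (reduction R Λ).IsTriangulated := by unfold reduction; infer_instance

instance : (reduction R Λ).Additive := inferInstance

variable {R Λ}

variable (R) in
/-- Reduction of complexes modulo the maximal ideal. -/
abbrev reduceComplex (C : CochainComplex (ModuleCat.{u} Λ) ℤ) :
    CochainComplex (ModuleCat.{u} (Fibre R Λ)) ℤ :=
  ((reduceModule R Λ).mapHomologicalComplex _).obj C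

lemma IsBoundedProj.reduce {C : CochainComplex (ModuleCat.{u} Λ) ℤ} (hC : IsBoundedProj Λ C) :
    IsBoundedProj (Fibre R Λ) (reduceComplex R C) := by
  obtain ⟨h, a, b, hab⟩ := hC
  exact ⟨fun i => (h i).reduce R, a, b,
    fun i hi => Functor.map_isZero (reduceModule R Λ) (hab i hi)⟩

lemma IsConcentrated.reduce {C : CochainComplex (ModuleCat.{u} Λ) ℤ} (hC : IsConcentrated C) :
    IsConcentrated (reduceComplex R C) :=
  fun i h h' => Functor.map_isZero (reduceModule R Λ) (hC i h h')

lemma reduction_obj_kbOf {C : CochainComplex (ModuleCat.{u} Λ) ℤ} (hC : IsBoundedProj Λ C) :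
    (reduction R Λ).obj (kbOf C hC) = kbOf (reduceComplex R C) hC.reduce := rfl

lemma reduction_map_kbMap {C D : CochainComplex (ModuleCat.{u} Λ) ℤ} (hC : IsBoundedProj Λ C)
    (hD : IsBoundedProj Λ D) (f : C ⟶ D) :
    (reduction R Λ).map (kbMap hC hD f) =
      kbMap hC.reduce hD.reduce (((reduceModule R Λ).mapHomologicalComplex _).map f) := rfl

lemma reduceModule_map_surjective {P Q : ModuleCat.{u} Λ} (hP : IsFGProj Λ P)
    (g : (reduceModule R Λ).obj P ⟶ (reduceModule R Λ).obj Q) :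
    ∃ f : P ⟶ Q, (reduceModule R Λ).map f = g := by
  have := hP.2
  let I := fibreIdeal R Λ
  let g' : P →ₗ[Λ] (Q ⧸ I • (⊤ : Submodule Λ Q)) :=
    { toFun := fun x => g.hom (Submodule.Quotient.mk x)
      map_add' := fun x y => map_add g.hom (Submodule.Quotient.mk x) (Submodule.Quotient.mk y)
      map_smul' := fun a x => map_smul g.hom (Ideal.Quotient.mk I a) (Submodule.Quotient.mk x) }
  obtain ⟨f, hf⟩ := Module.projective_lifting_property (Submodule.mkQ (I • (⊤ : Submodule Λ Q))) g'
    (Submodule.mkQ_surjective _)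
  refine ⟨ModuleCat.ofHom f, ModuleCat.hom_ext (LinearMap.ext fun x => ?_)⟩
  obtain ⟨x, rfl⟩ := Submodule.Quotient.mk_surjective _ x
  exact LinearMap.congr_fun hf x

lemma reduceModule_map_scalarEnd {r : R} (hr : r ∈ IsLocalRing.maximalIdeal R)
    (N : ModuleCat.{u} Λ) : (reduceModule R Λ).map (scalarEnd r N) = 0 := by
  refine ModuleCat.hom_ext (LinearMap.ext fun x => ?_)
  obtain ⟨x, rfl⟩ := Submodule.Quotient.mk_surjective _ x
  exact (Submodule.Quotient.mk_eq_zero _).2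
    (Submodule.smul_mem_smul (Ideal.mem_map_of_mem _ hr) Submodule.mem_top)

/-- The image of `f` lies in `𝔪Q`, which is contained in the image of `Q^k → Q` given by the
generators `r i`. Projectivity of `P` lifts `f` through this map. -/
lemma exists_sum_of_reduceModule_map_eq_zero {k : ℕ} {r : Fin k → R}
    (hr : Ideal.span (Set.range r) = IsLocalRing.maximalIdeal R)
    {P Q : ModuleCat.{u} Λ} (hP : IsFGProj Λ P) {f : P ⟶ Q}
    (hf : (reduceModule R Λ).map f = 0) :
    ∃ h : Fin k → (P ⟶ Q), f = ∑ i, h i ≫ scalarEnd (r i) Q := by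
  have := hP.2
  let I := fibreIdeal R Λ
  let σ : (Fin k → Q) →ₗ[Λ] Q := ∑ i, (scalarEnd (r i) Q).hom ∘ₗ LinearMap.proj i
  have hσ : ∀ v, σ v = ∑ i, algebraMap R Λ (r i) • v i := by
    intro v
    simp only [σ, LinearMap.sum_apply, LinearMap.comp_apply, LinearMap.proj_apply]
    rfl
  have hI : I = Ideal.span (Set.range fun i => algebraMap R Λ (r i)) := by
    simp only [I, fibreIdeal]
    rw [← hr, Ideal.map_span, ← Set.range_comp]
    rfl
  have hle : I • (⊤ : Submodule Λ Q) ≤ LinearMap.range σ := by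
    rw [Submodule.smul_le]
    intro a ha x _
    rw [hI] at ha
    refine Submodule.span_induction (p := fun a _ => a • x ∈ LinearMap.range σ) ?_ ?_ ?_ ?_ ha
    · rintro _ ⟨i, rfl⟩
      refine ⟨Pi.single i x, ?_⟩
      rw [hσ, Finset.sum_eq_single i]
      · simp
      · intro j _ hj; simp [hj]
      · simp
    · simp
    · intro a b _ _ ha hb
      rw [add_smul]
      exact add_mem ha hb
    · intro c a _ ha
      rw [smul_eq_mul, mul_smul]
      exact Submodule.smul_mem _ _ ha
  have hfr : ∀ x, f.hom x ∈ LinearMap.range σ := fun x => hle <| by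
    have := LinearMap.congr_fun (congrArg ModuleCat.Hom.hom hf) (Submodule.Quotient.mk x)
    exact (Submodule.Quotient.mk_eq_zero _).1 this
  obtain ⟨s, hs⟩ := Module.projective_lifting_property σ.rangeRestrict
    (f.hom.codRestrict _ hfr) σ.surjective_rangeRestrict
  refine ⟨fun i => ModuleCat.ofHom (LinearMap.proj i ∘ₗ s), ModuleCat.hom_ext
    (LinearMap.ext fun x => ?_)⟩
  have := congrArg Subtype.val (LinearMap.congr_fun hs x)
  rw [ModuleCat.hom_sum, LinearMap.sum_apply]
  exact this.symm.trans (hσ _)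

lemma reduce_cochain_surjective {C D : CochainComplex (ModuleCat.{u} Λ) ℤ}
    (hC : IsBoundedProj Λ C) {n : ℤ} (z : Cochain (reduceComplex R C) (reduceComplex R D) n) :
    ∃ y : Cochain C D n, y.map (reduceModule R Λ) = z := by
  choose f hf using fun (p q : ℤ) (hpq : p + n = q) =>
    reduceModule_map_surjective (hC.proj p) (z.v p q hpq)
  exact ⟨Cochain.mk f, by ext p q hpq : 1; exact hf p q hpq⟩

lemma exists_sum_of_map_cochain_eq_zero {k : ℕ} {r : Fin k → R}
    (hr : Ideal.span (Set.range r) = IsLocalRing.maximalIdeal R)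
    {C D : CochainComplex (ModuleCat.{u} Λ) ℤ} (hC : IsBoundedProj Λ C) {n : ℤ}
    {z : Cochain C D n} (hz : z.map (reduceModule R Λ) = 0) :
    ∃ y : Fin k → Cochain C D n,
      z = ∑ i, (y i).comp (Cochain.ofHom (scalarChain (r i) D)) (add_zero n) := by
  choose h hh using fun (p q : ℤ) (hpq : p + n = q) =>
    exists_sum_of_reduceModule_map_eq_zero hr (hC.proj p) (f := z.v p q hpq)
      (Cochain.congr_v hz p q hpq)
  refine ⟨fun i => Cochain.mk fun p q hpq => h p q hpq i, ?_⟩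
  ext p q hpq : 1
  rw [hh p q hpq]
  rw [cochain_sum_v]
  simp

/-- A 1-cochain over the fibre lifts by projectivity, the lift is a coboundary over `Λ`, and the
bounding 0-cochain is then reduced. -/
lemma HomVanishes.reduction_kbOf {C D : CochainComplex (ModuleCat.{u} Λ) ℤ}
    (hC : IsBoundedProj Λ C) (hD : IsBoundedProj Λ D) (hC' : IsConcentrated C)
    (hD' : IsConcentrated D) (h : HomVanishes (kbOf C hC) (kbOf D hD)) :
    HomVanishes ((reduction R Λ).obj (kbOf C hC)) ((reduction R Λ).obj (kbOf D hD)) := by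
  rw [reduction_obj_kbOf, reduction_obj_kbOf,
    homVanishes_kbOf_iff_of_isConcentrated _ _ hC'.reduce hD'.reduce]
  rw [homVanishes_kbOf_iff_of_isConcentrated _ _ hC' hD'] at h
  intro z
  obtain ⟨w, rfl⟩ := reduce_cochain_surjective hC z
  obtain ⟨y, rfl⟩ := h w
  exact ⟨y.map _, by rw [δ_map]⟩

/-- If `Hom(C, D[1]) = 0` for two-term complexes `C` and `D`, then every morphism between their
reductions lifts. -/
lemma exists_reduction_map_eq_of_homVanishes [IsNoetherianRing R]
    {C D : CochainComplex (ModuleCat.{u} Λ) ℤ}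
    (hC : IsBoundedProj Λ C) (hD : IsBoundedProj Λ D) (hC' : IsConcentrated C)
    (hD' : IsConcentrated D) (h : HomVanishes (kbOf C hC) (kbOf D hD))
    (g : (reduction R Λ).obj (kbOf C hC) ⟶ (reduction R Λ).obj (kbOf D hD)) :
    ∃ f, (reduction R Λ).map f = g := by
  rw [homVanishes_kbOf_iff_of_isConcentrated _ _ hC' hD'] at h
  obtain ⟨g, rfl⟩ := kbMap_surjective hC.reduce hD.reduce g
  obtain ⟨k, r, hr⟩ := Submodule.fg_iff_exists_fin_generating_family.1
    ((isNoetherianRing_iff_ideal_fg R).1 inferInstance (IsLocalRing.maximalIdeal R))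
  -- The lift `φ` is only a cochain. Its differential reduces to zero, hence has the form `∑ r i • z
  -- i`. Each `z i` equals `δ (y i)` by hypothesis, so subtracting `∑ r i • y i` gives a chain map
  -- without changing the reduction.
  obtain ⟨φ, hφ⟩ := reduce_cochain_surjective hC (Cochain.ofHom g)
  have hδ : (δ 0 1 φ).map (reduceModule R Λ) = 0 := by
    rw [← δ_map, hφ, δ_ofHom]
  obtain ⟨z, hz⟩ := exists_sum_of_map_cochain_eq_zero hr hC hδ
  choose y hy using fun i => h (z i)
  let ψ : Cochain C D 0 := ∑ i, (y i).comp (Cochain.ofHom (scalarChain (r i) D)) (add_zero 0)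
  have hψ : δ 0 1 ψ = δ 0 1 φ := by
    rw [hz, ← δ_hom_apply ℤ, map_sum]
    refine Finset.sum_congr rfl fun i _ => ?_
    rw [δ_hom_apply, δ_comp_ofHom, hy]
  have hψ' : ψ.map (reduceModule R Λ) = 0 := by
    ext p : 1
    rw [Cochain.map_v, cochain_sum_v, Functor.map_sum]
    refine Finset.sum_eq_zero fun i _ => ?_
    have hri : r i ∈ IsLocalRing.maximalIdeal R := hr ▸ Ideal.subset_span ⟨i, rfl⟩
    rw [Cochain.comp_v _ _ (add_zero 0) p p p (add_zero p) (add_zero p), Cochain.ofHom_v, Functor.map_comp,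
      scalarChain_f, reduceModule_map_scalarEnd hri, comp_zero]
    rfl
  refine ⟨kbMap hC hD (Cocycle.homOf (Cocycle.mk (φ - ψ) 1 rfl (by rw [δ_sub, hψ, sub_self]))), ?_⟩
  rw [reduction_map_kbMap]
  congr 1
  apply Cochain.ofHom_injective
  rw [← hφ, ← Cochain.map_ofHom, Cocycle.cochain_ofHom_homOf_eq_coe]
  change (φ - ψ).map _ = _
  rw [Cochain.map_sub, hψ', sub_zero]

end Lifting

/-! ### Retracts and split idempotents -/

section Retracts

variable {A : Type u} [Ring A]

lemma IsFGProj.of_retract {P Q : ModuleCat.{u} A} (i : Q ⟶ P) (p : P ⟶ Q) (h : i ≫ p = 𝟙 Q)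
    (hP : IsFGProj A P) : IsFGProj A Q := by
  obtain ⟨h₁, h₂⟩ := hP
  have hip : p.hom ∘ₗ i.hom = LinearMap.id := congrArg ModuleCat.Hom.hom h
  exact ⟨Module.Finite.of_surjective p.hom fun x => ⟨i.hom x, LinearMap.congr_fun hip x⟩,
    Module.Projective.of_split i.hom p.hom hip⟩

lemma isZero_of_retract {𝒞 : Type*} [Category 𝒞] [HasZeroMorphisms 𝒞] {X Y : 𝒞} (i : Y ⟶ X)
    (p : X ⟶ Y) (h : i ≫ p = 𝟙 Y) (hX : IsZero X) : IsZero Y := by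
  rw [IsZero.iff_id_eq_zero, ← h, hX.eq_of_tgt i 0, zero_comp]

lemma retract_f {C D : CochainComplex (ModuleCat.{u} A) ℤ} {i : D ⟶ C} {p : C ⟶ D}
    (h : i ≫ p = 𝟙 D) (n : ℤ) : i.f n ≫ p.f n = 𝟙 (D.X n) := by
  rw [← HomologicalComplex.comp_f, h, HomologicalComplex.id_f]

lemma IsBoundedProj.of_retract {C D : CochainComplex (ModuleCat.{u} A) ℤ} (i : D ⟶ C) (p : C ⟶ D)
    (h : i ≫ p = 𝟙 D) (hC : IsBoundedProj A C) : IsBoundedProj A D := by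
  obtain ⟨h₁, a, b, hab⟩ := hC
  exact ⟨fun n => (h₁ n).of_retract _ _ (retract_f h n), a, b,
    fun n hn => isZero_of_retract _ _ (retract_f h n) (hab n hn)⟩

lemma IsConcentrated.of_retract {C D : CochainComplex (ModuleCat.{u} A) ℤ} (i : D ⟶ C) (p : C ⟶ D)
    (h : i ≫ p = 𝟙 D) (hC : IsConcentrated C) : IsConcentrated D :=
  fun n h₁ h₂ => isZero_of_retract _ _ (retract_f h n) (hC n h₁ h₂)

/-- If an idempotent and its complement split on an indecomposable object, then the idempotent
is trivial. -/
lemma eq_zero_or_eq_id_of_split {𝒞 : Type*} [Category 𝒞] [Preadditive 𝒞] [HasBinaryBiproducts 𝒞]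
    {X Y Z : 𝒞} (hX : Indecomposable X) {i : Y ⟶ X} {p : X ⟶ Y} {j : Z ⟶ X} {q : X ⟶ Z}
    (hi : i ≫ p = 𝟙 Y) (hj : j ≫ q = 𝟙 Z) (h : p ≫ i + q ≫ j = 𝟙 X) :
    p ≫ i = 0 ∨ p ≫ i = 𝟙 X := by
  have hiq : i ≫ q = 0 := by
    have h1 : i ≫ (p ≫ i + q ≫ j) ≫ q = i ≫ q := by rw [h, Category.id_comp]
    simpa [reassoc_of% hi, hj] using h1
  have hjp : j ≫ p = 0 := by
    have h1 : j ≫ (p ≫ i + q ≫ j) ≫ p = j ≫ p := by rw [h, Category.id_comp]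
    simpa [reassoc_of% hj, hi] using h1
  let e : X ≅ Y ⊞ Z :=
    { hom := biprod.lift p q
      inv := biprod.desc i j
      hom_inv_id := by rw [biprod.lift_desc, h]
      inv_hom_id := by ext <;> simp [hi, hj, hiq, hjp] }
  rcases hX.2 Y Z e with hY | hZ
  · left
    rw [hY.eq_of_tgt p 0, zero_comp]
  · right
    rw [hZ.eq_of_tgt q 0, zero_comp, add_zero] at h
    exact h

/-- The ring homomorphism from chain endomorphisms to endomorphisms in `K^b(proj A)`. -/
def kbEnd {C : CochainComplex (ModuleCat.{u} A) ℤ} (hC : IsBoundedProj A C) :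
    End C →+* End (kbOf C hC) where
  toFun f := kbMap hC hC f
  map_one' := ObjectProperty.hom_ext _ ((HomotopyCategory.quotient _ _).map_id C)
  map_mul' f g := ObjectProperty.hom_ext _ ((HomotopyCategory.quotient _ _).map_comp g f)
  map_zero' := ObjectProperty.hom_ext _ ((HomotopyCategory.quotient _ _).map_zero C C)
  map_add' f g := ObjectProperty.hom_ext _ ((HomotopyCategory.quotient _ _).map_add (f := f) (g := g))

lemma kbMap_comp {C D E : CochainComplex (ModuleCat.{u} A) ℤ} (hC : IsBoundedProj A C)
    (hD : IsBoundedProj A D) (hE : IsBoundedProj A E) (f : C ⟶ D) (g : D ⟶ E) :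
    kbMap hC hE (f ≫ g) = kbMap hC hD f ≫ kbMap hD hE g :=
  ObjectProperty.hom_ext _ ((HomotopyCategory.quotient _ _).map_comp f g)

lemma kbMap_id {C : CochainComplex (ModuleCat.{u} A) ℤ} (hC : IsBoundedProj A C) :
    kbMap hC hC (𝟙 C) = 𝟙 _ :=
  ObjectProperty.hom_ext _ ((HomotopyCategory.quotient _ _).map_id C)

end Retracts

/-! ### Chain endomorphism algebras and local endomorphism rings -/

section EndomorphismAlgebra

variable {R : Type u} [CommRing R] {Λ : Type u} [Ring Λ] [Algebra R Λ]

/-- The `R`-algebra structure on the endomorphisms of a complex of `Λ`-modules. -/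
abbrev chainEndAlgebra (C : CochainComplex (ModuleCat.{u} Λ) ℤ) : Algebra R (End C) :=
  RingHom.toAlgebra'
    { toFun := fun r => scalarChain r C
      map_one' := by
        refine HomologicalComplex.hom_ext _ _ fun n => ModuleCat.hom_ext (LinearMap.ext fun x => ?_)
        exact (congrArg (· • x) (map_one (algebraMap R Λ))).trans (one_smul _ x)
      map_mul' := fun r s => by
        refine HomologicalComplex.hom_ext _ _ fun n => ModuleCat.hom_ext (LinearMap.ext fun x => ?_)
        exact (congrArg (· • x) (map_mul (algebraMap R Λ) r s)).trans (mul_smul _ _ x)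
      map_zero' := by
        refine HomologicalComplex.hom_ext _ _ fun n => ModuleCat.hom_ext (LinearMap.ext fun x => ?_)
        exact (congrArg (· • x) (map_zero (algebraMap R Λ))).trans (zero_smul _ x)
      map_add' := fun r s => by
        refine HomologicalComplex.hom_ext _ _ fun n => ModuleCat.hom_ext (LinearMap.ext fun x => ?_)
        exact (congrArg (· • x) (map_add (algebraMap R Λ) r s)).trans (add_smul _ _ x) }
    (fun r f => by
      refine HomologicalComplex.hom_ext _ _ fun n => ModuleCat.hom_ext (LinearMap.ext fun x => ?_)
      exact (map_smul (f.f n).hom (algebraMap R Λ r) x).symm)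

/-- A chain endomorphism is determined by its values on finitely many generators in the finitely
many nonzero degrees. So `End C` embeds in a finite module over the Noetherian ring `R`, and Fitting
idempotents are available in it. -/
lemma finite_chainEnd [IsNoetherianRing R] [Module.Finite R Λ]
    {C : CochainComplex (ModuleCat.{u} Λ) ℤ} (hC : IsBoundedProj Λ C) :
    letI := chainEndAlgebra (R := R) C
    Module.Finite R (End C) := by
  let := chainEndAlgebra (R := R) C
  let : ∀ n, Module R (C.X n) := fun n => Module.compHom _ (algebraMap R Λ)
  have : ∀ n, IsScalarTower R Λ (C.X n) := fun n =>
    ⟨fun r a x => by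
      rw [Algebra.smul_def, mul_smul]
      rfl⟩
  have hfin := fun n => (hC.proj n).1
  have : ∀ n, Module.Finite R (C.X n) := fun n => Module.Finite.trans Λ _
  choose k g hg using fun n => Module.Finite.exists_fin (R := Λ) (M := C.X n)
  obtain ⟨a, b, hab⟩ := hC.bounded
  let φ : End C →ₗ[R] ((n : Finset.Icc a b) → Fin (k n) → C.X n) :=
    { toFun := fun f n j => (HomologicalComplex.Hom.f f (n : ℤ)).hom (g n j)
      map_add' := fun f f' => rfl
      map_smul' := fun r f => by rw [Algebra.smul_def]; rfl }
  refine Module.Finite.of_injective φ fun f f' h => ?_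
  refine HomologicalComplex.hom_ext _ _ fun n => ?_
  by_cases hn : n ∈ Finset.Icc a b
  · refine ModuleCat.hom_ext (LinearMap.ext_on (hg n) ?_)
    rintro _ ⟨j, rfl⟩
    exact congrFun (congrFun h ⟨n, hn⟩) j
  · exact (hab n (by rw [Finset.mem_Icc] at hn; lia)).eq_of_src _ _

/-- Retracts in `K^b(proj Λ)` of two-term complexes are isomorphic to two-term complexes. -/
lemma exists_iso_kbOf_of_retract (R : Type u) [CommRing R] [IsLocalRing R] [IsNoetherianRing R]
    [IsAdicComplete (IsLocalRing.maximalIdeal R) R] {Λ : Type u} [Ring Λ] [Algebra R Λ]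
    [Module.Finite R Λ] {C : CochainComplex (ModuleCat.{u} Λ) ℤ}
    (hC : IsBoundedProj Λ C) (hC' : IsConcentrated C) {X : Kb Λ} (i : X ⟶ kbOf C hC)
    (p : kbOf C hC ⟶ X) (h : i ≫ p = 𝟙 X) :
    ∃ (D : CochainComplex (ModuleCat.{u} Λ) ℤ) (hD : IsBoundedProj Λ D),
      IsConcentrated D ∧ Nonempty (X ≅ kbOf D hD) := by
  let := chainEndAlgebra (R := R) C
  have := finite_chainEnd (R := R) hC
  obtain ⟨a, ha⟩ := kbMap_surjective hC hC (p ≫ i)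
  -- The representative `a` of `p ≫ i` is idempotent only up to homotopy. The element `e` is a
  -- strictly idempotent chain map in the same homotopy class, so it splits in complexes and its
  -- image is again two-term.
  obtain ⟨e, he, -, -, h3⟩ := exists_fitting_idempotent R (kbEnd hC) a
  have ha' : kbEnd hC a = p ≫ i := ha
  have h4 : kbEnd hC e = p ≫ i := by
    rw [h3, ha']
    rw [ha', IsIdempotentElem, End.mul_def, Category.assoc, reassoc_of% h]
  obtain ⟨D, j, q, hj, hq⟩ := IsIdempotentComplete.idempotents_split C e he
  have hD := hC.of_retract j q hj
  have hqj : kbMap hC hD q ≫ kbMap hD hC j = p ≫ i := by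
    rw [← kbMap_comp, hq]; exact h4
  have hjq : kbMap hD hC j ≫ kbMap hC hD q = 𝟙 _ := by
    rw [← kbMap_comp, hj, kbMap_id]
  refine ⟨D, hD, hC'.of_retract j q hj, ⟨?_⟩⟩
  exact
    { hom := i ≫ kbMap hC hD q
      inv := kbMap hD hC j ≫ p
      hom_inv_id := by
        rw [Category.assoc, reassoc_of% hqj, h, Category.comp_id, h]
      inv_hom_id := by
        rw [Category.assoc, ← reassoc_of% hqj, hjq, Category.comp_id, hjq] }

/-- Endomorphism rings of indecomposable objects of `K^b(proj Λ)` are local. -/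
lemma isUnit_or_isUnit_one_sub_of_indecomposable (R : Type u) [CommRing R] [IsLocalRing R] [IsNoetherianRing R]
    [IsAdicComplete (IsLocalRing.maximalIdeal R) R] {Λ : Type u} [Ring Λ] [Algebra R Λ]
    [Module.Finite R Λ] {X : Kb Λ} (hX : Indecomposable X) (f : End X) :
    IsUnit f ∨ IsUnit (1 - f) := by
  obtain ⟨X, hC⟩ := X
  obtain ⟨C, rfl⟩ := X.quotient_obj_surjective
  change IsBoundedProj Λ C at hC
  let := chainEndAlgebra (R := R) C
  have := finite_chainEnd (R := R) hC
  obtain ⟨a, rfl⟩ := kbMap_surjective hC hC f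
  obtain ⟨e, he, h1, h0, -⟩ := exists_fitting_idempotent R (kbEnd hC) a
  -- Splitting `e` and `1 - e` strictly decomposes `C`. Indecomposability in the homotopy category
  -- then makes the class of `e` equal to 0 or 1, and the Fitting property turns this into
  -- invertibility of `1 - f` or `f`.
  obtain ⟨D, j, q, hj, hq⟩ := IsIdempotentComplete.idempotents_split C e he
  obtain ⟨D', j', q', hj', hq'⟩ := IsIdempotentComplete.idempotents_split C (1 - e : End C)
    he.one_sub
  have hD := hC.of_retract j q hj
  have hD' := hC.of_retract j' q' hj'
  have hqe : kbMap hC hD q ≫ kbMap hD hC j = kbEnd hC e := by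
    rw [← kbMap_comp, hq]; rfl
  have hqe' : kbMap hC hD' q' ≫ kbMap hD' hC j' =
      kbEnd hC (1 - e : End C) := by
    rw [← kbMap_comp, hq']; rfl
  have := eq_zero_or_eq_id_of_split hX (i := kbMap hD hC j) (p := kbMap hC hD q)
    (j := kbMap hD' hC j') (q := kbMap hC hD' q') (by rw [← kbMap_comp, hj, kbMap_id])
    (by rw [← kbMap_comp, hj', kbMap_id]) (by
      rw [hqe, hqe']
      refine (RingHom.map_add (kbEnd hC) e (1 - e)).symm.trans ?_
      rw [add_sub_cancel]
      exact RingHom.map_one (kbEnd hC))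
  rw [hqe] at this
  rcases this with h | h
  · right
    have := h0 h
    rwa [RingHom.map_sub, RingHom.map_one] at this
  · exact Or.inl (h1 h)

end EndomorphismAlgebra

/-! ### Nakayama's lemma in the homotopy category -/

section Nakayama

open CochainComplex.HomComplex

variable {R : Type u} [CommRing R] [IsLocalRing R] [IsNoetherianRing R] {Λ : Type u} [Ring Λ]
  [Algebra R Λ] [Module.Finite R Λ]

/-- Nakayama over `R` gives surjectivity, as `P` is a finite `R`-module; a surjective endomorphism
of a Noetherian module is injective. -/
lemma isIso_of_reduceModule_map_eq_id {P : ModuleCat.{u} Λ} (hP : Module.Finite Λ P) (f : P ⟶ P)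
    (hf : (reduceModule R Λ).map f = 𝟙 _) : IsIso f := by
  let : Module R P := Module.compHom _ (algebraMap R Λ)
  have : IsScalarTower R Λ P := ⟨fun r a x => by
    rw [Algebra.smul_def, mul_smul]
    rfl⟩
  have : Module.Finite R P := Module.Finite.trans Λ _
  let g : P →ₗ[R] P := f.hom.restrictScalars R
  have hle : ∀ x ∈ fibreIdeal R Λ • (⊤ : Submodule Λ P),
      x ∈ IsLocalRing.maximalIdeal R • (⊤ : Submodule R P) := by
    have hcl : ∀ (c : Λ), ∀ y ∈ IsLocalRing.maximalIdeal R • (⊤ : Submodule R P),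
        c • y ∈ IsLocalRing.maximalIdeal R • (⊤ : Submodule R P) := by
      intro c y hy
      refine Submodule.smul_induction_on hy (fun r hr n _ => ?_) fun y z hy hz => ?_
      · have : c • r • n = r • c • n := by
          change c • algebraMap R Λ r • n = algebraMap R Λ r • c • n
          rw [← mul_smul, ← mul_smul, Algebra.commutes]
        rw [this]
        exact Submodule.smul_mem_smul hr Submodule.mem_top
      · rw [smul_add]
        exact add_mem hy hz
    intro x hx
    refine Submodule.smul_induction_on hx (fun a ha n _ => ?_) fun y z hy hz => add_mem hy hz
    refine Submodule.span_induction
      (p := fun a _ => a • n ∈ IsLocalRing.maximalIdeal R • (⊤ : Submodule R P)) ?_ ?_ ?_ ?_ ha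
    · rintro _ ⟨r, hr, rfl⟩
      exact Submodule.smul_mem_smul (N := (⊤ : Submodule R P)) hr Submodule.mem_top
    · rw [zero_smul]
      exact zero_mem _
    · intro a b _ _ ha hb
      rw [add_smul]
      exact add_mem ha hb
    · intro c a _ ha
      rw [smul_eq_mul, mul_smul]
      exact hcl c _ ha
  have hsurj : Function.Surjective g := by
    rw [← LinearMap.range_eq_top, eq_top_iff]
    refine Submodule.le_of_le_smul_of_le_jacobson_bot (I := IsLocalRing.maximalIdeal R)
      Module.Finite.fg_top (IsLocalRing.maximalIdeal_le_jacobson _) fun x _ => ?_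
    rw [Submodule.mem_sup]
    refine ⟨g x, ⟨x, rfl⟩, x - g x, hle _ ?_, by abel⟩
    rw [← Submodule.Quotient.eq]
    exact (LinearMap.congr_fun (congrArg ModuleCat.Hom.hom hf) (Submodule.Quotient.mk x)).symm
  have hinj : Function.Injective g := IsNoetherian.injective_of_surjective_endomorphism g hsurj
  exact (ConcreteCategory.isIso_iff_bijective f).2 ⟨hinj, hsurj⟩

/-- An endomorphism in `K^b(proj Λ)` whose reduction is the identity is an isomorphism. -/
lemma isIso_of_reduction_map_eq_id {X : Kb Λ} (f : X ⟶ X)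
    (hf : (reduction R Λ).map f = 𝟙 _) : IsIso f := by
  obtain ⟨X, hC⟩ := X
  obtain ⟨C, rfl⟩ := X.quotient_obj_surjective
  change IsBoundedProj Λ C at hC
  obtain ⟨f, rfl⟩ := kbMap_surjective hC hC f
  have hq : (HomotopyCategory.quotient _ _).map
      (((reduceModule R Λ).mapHomologicalComplex (ComplexShape.up ℤ)).map f) =
      (HomotopyCategory.quotient _ _).map (𝟙 (reduceComplex R C)) := by
    rw [CategoryTheory.Functor.map_id]
    exact congrArg (kbProj _).ι.map hf
  obtain ⟨z, hz⟩ := Cochain.equivHomotopy _ _ (HomotopyCategory.homotopyOfEq _ _ hq)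
  -- The homotopy from the reduction of `f` to the identity is lifted to a cochain `y` of degree
  -- `-1`. Replacing `f` by the homotopic map `f - δ y` makes the reduction equal to the identity on
  -- the nose, so Nakayama applies in each degree.
  obtain ⟨y, rfl⟩ := reduce_cochain_surjective hC z
  let f' : C ⟶ C := Cocycle.homOf (Cocycle.mk (Cochain.ofHom f - δ (-1) 0 y) 1 rfl (by
    rw [δ_sub, δ_ofHom, δ_δ, sub_zero]))
  have hf' : Cochain.ofHom f' = Cochain.ofHom f - δ (-1) 0 y :=
    Cocycle.cochain_ofHom_homOf_eq_coe _
  have hff' : kbMap hC hC f = kbMap hC hC f' :=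
    ObjectProperty.hom_ext _ (HomotopyCategory.eq_of_homotopy _ _
      ((Cochain.equivHomotopy f f').symm ⟨y, by rw [hf']; abel⟩))
  have hred : ((reduceModule R Λ).mapHomologicalComplex (ComplexShape.up ℤ)).map f' =
      𝟙 (reduceComplex R C) := by
    apply Cochain.ofHom_injective
    rw [← Cochain.map_ofHom, hf', Cochain.map_sub, ← δ_map, Cochain.map_ofHom, hz]
    abel
  have : ∀ n, IsIso (f'.f n) := fun n =>
    isIso_of_reduceModule_map_eq_id (R := R) (hC.proj n).1 _
      (congrArg (fun g => HomologicalComplex.Hom.f g n) hred)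
  have : IsIso f' := HomologicalComplex.Hom.isIso_of_components f'
  rw [hff']
  refine ⟨kbMap hC hC (inv f'), ?_, ?_⟩
  · rw [← kbMap_comp, IsIso.hom_inv_id, kbMap_id]
  · rw [← kbMap_comp, IsIso.inv_hom_id, kbMap_id]

end Nakayama

/-! ### Generation of `K^b(proj)` and its passage to the fibre -/

section Generation

open HomologicalComplex Pretriangulated

variable {A : Type u} [Ring A]

lemma isBoundedProj_single (n : ℤ) {P : ModuleCat.{u} A} (hP : IsFGProj A P) :
    IsBoundedProj A ((single _ (ComplexShape.up ℤ) n).obj P) := by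
  refine ⟨fun i => ?_, n, n, fun i hi => isZero_single_obj_X _ _ _ _ (by lia)⟩
  by_cases h : i = n
  · subst h
    exact hP.of_iso (singleObjXSelf (ComplexShape.up ℤ) i P).symm
  · exact IsFGProj.of_isZero (isZero_single_obj_X _ _ _ _ h)

/-- Retracts of complexes give retracts in `K^b(proj A)`. -/
def _root_.CategoryTheory.Retract.kbOf {C D : CochainComplex (ModuleCat.{u} A) ℤ}
    (ρ : Retract D C) (hD : IsBoundedProj A D) (hC : IsBoundedProj A C) :
    Retract (kbOf D hD) (kbOf C hC) where
  i := kbMap hD hC ρ.i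
  r := kbMap hC hD ρ.r
  retract := by rw [← kbMap_comp, ρ.retract, kbMap_id]

variable {Q : ObjectProperty (Kb A)} [Q.IsTriangulated]

/-- A triangulated subcategory containing the outer terms of a degreewise split short exact
sequence contains its middle term. -/
lemma prop_of_degreewiseSplit [Q.IsClosedUnderIsomorphisms]
    (S : ShortComplex (CochainComplex (ModuleCat.{u} A) ℤ))
    (σ : ∀ n, (S.map (HomologicalComplex.eval _ _ n)).Splitting) (h₁ : IsBoundedProj A S.X₁)
    (h₂ : IsBoundedProj A S.X₂) (h₃ : IsBoundedProj A S.X₃)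
    (hQ₁ : Q (kbOf S.X₁ h₁)) (hQ₃ : Q (kbOf S.X₃ h₃)) : Q (kbOf S.X₂ h₂) := by
  let T := CochainComplex.trianglehOfDegreewiseSplit S σ
  let ι := (kbProj A).ι
  let m : ι.obj (kbOf S.X₃ h₃) ⟶ (ι.obj (kbOf S.X₁ h₁))⟦(1 : ℤ)⟧ := T.mor₃
  -- The connecting morphism lives in the ambient homotopy category; fullness of the inclusion,
  -- corrected by its shift isomorphism, brings it into `K^b(proj A)`.
  let δ : kbOf S.X₃ h₃ ⟶ (kbOf S.X₁ h₁)⟦(1 : ℤ)⟧ := (kbProj A).fullyFaithfulι.preimage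
    (X := kbOf S.X₃ h₃) (Y := (kbOf S.X₁ h₁)⟦(1 : ℤ)⟧)
    (m ≫ (ι.commShiftIso (1 : ℤ)).inv.app (kbOf S.X₁ h₁))
  let T' : Triangle (Kb A) := Triangle.mk (kbMap h₁ h₂ S.f) (kbMap h₂ h₃ S.g) δ
  have hT : T ∈ distTriang _ :=
    (HomotopyCategory.distinguished_iff_iso_trianglehOfDegreewiseSplit T).2 ⟨S, σ, ⟨Iso.refl _⟩⟩
  have hT' : ι.mapTriangle.obj T' ∈ distTriang _ := by
    refine isomorphic_distinguished _ hT _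
      (Triangle.isoMk _ _ (Iso.refl _) (Iso.refl _) (Iso.refl _) ?_ ?_ ?_)
    · exact (Category.comp_id _).trans (Category.id_comp _).symm
    · exact (Category.comp_id _).trans (Category.id_comp _).symm
    · have hδ : ι.map δ ≫ (ι.commShiftIso (1 : ℤ)).hom.app (kbOf S.X₁ h₁) = m := by
        rw [Functor.FullyFaithful.map_preimage, Category.assoc, Iso.inv_hom_id_app]
        exact Category.comp_id _
      have hm : m ≫ (𝟙 (ι.obj (kbOf S.X₁ h₁)))⟦(1 : ℤ)⟧' = 𝟙 _ ≫ m := by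
        rw [CategoryTheory.Functor.map_id, Category.comp_id, Category.id_comp]
      exact (congrArg (· ≫ (𝟙 (ι.obj (kbOf S.X₁ h₁)))⟦(1 : ℤ)⟧') hδ).trans hm
  exact Q.ext_of_isTriangulatedClosed₂ T' hT' hQ₁ hQ₃

/-- The top term of a bounded above complex is a degreewise split subcomplex. -/
lemma exists_degreewiseSplit_of_top (C : CochainComplex (ModuleCat.{u} A) ℤ) (b : ℤ)
    (hb : IsZero (C.X (b + 1))) :
    ∃ (D : CochainComplex (ModuleCat.{u} A) ℤ)
      (f : (single _ (ComplexShape.up ℤ) b).obj (C.X b) ⟶ C) (g : C ⟶ D) (w : f ≫ g = 0),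
      (∀ n, Nonempty (((ShortComplex.mk f g w).map (HomologicalComplex.eval _ _ n)).Splitting)) ∧ IsZero (D.X b) := by
  let f : (single _ (ComplexShape.up ℤ) b).obj (C.X b) ⟶ C :=
    mkHomFromSingle (𝟙 _) fun i hi => by
      obtain rfl : b + 1 = i := hi
      exact hb.eq_of_tgt _ _
  have hf : IsIso (f.f b) := by
    rw [mkHomFromSingle_f]
    infer_instance
  let S := ShortComplex.mk f (cokernel.π f) (cokernel.condition f)
  have hS : S.Exact := S.exact_of_g_is_cokernel (cokernelIsCokernel f)
  have hr : ∀ n, ∃ r, f.f n ≫ r = 𝟙 _ := by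
    intro n
    by_cases h : n = b
    · subst h
      exact ⟨inv (f.f n), IsIso.hom_inv_id _⟩
    · exact ⟨0, (isZero_single_obj_X _ _ _ _ h).eq_of_src _ _⟩
  choose r hr using hr
  have hepi : ∀ n, Epi ((S.map (HomologicalComplex.eval _ _ n)).g) := fun n =>
    inferInstanceAs (Epi ((HomologicalComplex.eval _ _ n).map (cokernel.π f)))
  refine ⟨cokernel f, f, cokernel.π f, cokernel.condition f, fun n => ⟨.ofExactOfRetraction _
    (hS.map (HomologicalComplex.eval _ _ n)) (r n) (hr n) (hepi n)⟩, ?_⟩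
  have h0 : (cokernel.π f).f b = 0 := by
    rw [← cancel_epi (f.f b), ← comp_f, cokernel.condition, zero_f, comp_zero]
  have : Epi ((cokernel.π f).f b) := hepi b
  rw [IsZero.iff_id_eq_zero, ← cancel_epi ((cokernel.π f).f b), h0, zero_comp, zero_comp]

/-- A triangulated subcategory containing all finitely generated projective modules, placed in
any degree, contains all bounded complexes of them. -/
lemma prop_of_prop_single [Q.IsClosedUnderIsomorphisms]
    (hQ : ∀ (n : ℤ) (P : ModuleCat.{u} A) (hP : IsFGProj A P),
      Q (kbOf _ (isBoundedProj_single n hP))) (X : Kb A) : Q X := by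
  -- Induction on the length `k` of the half-open interval `[a, a + k)` supporting the complex,
  -- peeling off the term in the top degree.
  have key : ∀ (k : ℕ) (a : ℤ) (C : CochainComplex (ModuleCat.{u} A) ℤ) (hC : IsBoundedProj A C),
      (∀ i, (i < a ∨ a + k ≤ i) → IsZero (C.X i)) → Q (kbOf C hC) := by
    intro k a
    induction k with
    | zero =>
      intro C hC h
      refine Q.prop_of_isZero ?_
      rw [IsZero.iff_id_eq_zero, ← kbMap_id]
      have : 𝟙 C = 0 := hom_ext _ _ fun n => (h n (by lia)).eq_of_tgt _ _
      rw [this]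
      exact map_zero (kbEnd hC)
    | succ k ih =>
      intro C hC h
      obtain ⟨D, f, g, w, hσ, hD⟩ := exists_degreewiseSplit_of_top C (a + k) (h _ (by lia))
      let σ := fun n => (hσ n).some
      have hret : ∀ n, (σ n).s ≫ g.f n = 𝟙 (D.X n) := fun n => (σ n).s_g
      have hDb : IsBoundedProj A D := by
        obtain ⟨h₁, c, d, hcd⟩ := hC
        exact ⟨fun n => (h₁ n).of_retract _ _ (hret n), c, d,
          fun n hn => isZero_of_retract _ _ (hret n) (hcd n hn)⟩
      refine prop_of_degreewiseSplit (ShortComplex.mk f g w) σ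
        (isBoundedProj_single _ (hC.proj _)) hC hDb (hQ _ _ (hC.proj _)) (ih D hDb fun i hi => ?_)
      by_cases hi' : i = a + k
      · rw [hi']
        exact hD
      · exact isZero_of_retract _ _ (hret i) (h i (by lia))
  obtain ⟨X, hC⟩ := X
  obtain ⟨C, rfl⟩ := X.quotient_obj_surjective
  change IsBoundedProj A C at hC
  obtain ⟨a, b, hab⟩ := hC.bounded
  exact key (b + 1 - a).toNat a C hC fun i hi => hab i (by lia)

variable {R : Type u} [CommRing R] [IsLocalRing R] {Λ : Type u} [Ring Λ] [Algebra R Λ]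

/-- Every finitely generated projective `Λ/𝔪Λ`-module is a retract of the reduction of a finitely
generated projective `Λ`-module. -/
lemma exists_retract_reduceModule {P : ModuleCat.{u} (Fibre R Λ)} (hP : IsFGProj (Fibre R Λ) P) :
    ∃ (N : ModuleCat.{u} Λ) (_ : IsFGProj Λ N), Nonempty (Retract P ((reduceModule R Λ).obj N)) := by
  obtain ⟨h₁, h₂⟩ := hP
  obtain ⟨k, x, hx⟩ := Module.Finite.exists_fin (R := Fibre R Λ) (M := P)
  let N := ModuleCat.of.{u} Λ (ULift.{u} (Fin k) → Λ)
  have hN : IsFGProj Λ N :=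
    ⟨inferInstanceAs (Module.Finite Λ (ULift.{u} (Fin k) → Λ)),
      inferInstanceAs (Module.Projective Λ (ULift.{u} (Fin k) → Λ))⟩
  let I := fibreIdeal R Λ
  let : Module Λ P := Module.compHom _ (Ideal.Quotient.mk I)
  let s : (ULift.{u} (Fin k) → Λ) →ₗ[Λ] P :=
    ∑ i, (LinearMap.toSpanSingleton Λ P (x i.down)) ∘ₗ LinearMap.proj i
  have hs : I • (⊤ : Submodule Λ N) ≤ LinearMap.ker s := by
    rw [Submodule.smul_le]
    intro a ha y _
    rw [LinearMap.mem_ker, map_smul]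
    change Ideal.Quotient.mk I a • s y = 0
    rw [Ideal.Quotient.eq_zero_iff_mem.2 ha, zero_smul]
  let t : (reduceModule R Λ).obj N →ₗ[Fibre R Λ] P :=
    { toFun := Submodule.liftQ _ s hs
      map_add' := map_add _
      map_smul' := by
        intro a y
        obtain ⟨a, rfl⟩ := Ideal.Quotient.mk_surjective a
        obtain ⟨y, rfl⟩ := Submodule.Quotient.mk_surjective _ y
        exact map_smul s a y }
  have ht : Function.Surjective t := by
    rw [← LinearMap.range_eq_top, eq_top_iff, ← hx, Submodule.span_le]
    rintro _ ⟨i, rfl⟩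
    refine ⟨Submodule.Quotient.mk (Pi.single ⟨i⟩ 1), ?_⟩
    change s (Pi.single ⟨i⟩ 1) = x i
    simp only [s, LinearMap.sum_apply, LinearMap.comp_apply, LinearMap.proj_apply]
    rw [Finset.sum_eq_single ⟨i⟩]
    · rw [Pi.single_eq_same]
      exact one_smul Λ (x i)
    · intro j _ hj
      rw [Pi.single_eq_of_ne hj, map_zero]
    · simp
  obtain ⟨v, hv⟩ := Module.projective_lifting_property t LinearMap.id ht
  exact ⟨N, hN, ⟨{ i := ModuleCat.ofHom v, r := ModuleCat.ofHom t, retract := ModuleCat.hom_ext hv }⟩⟩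

/-- The preimage under reduction of the thick subcategory generated by the reduction of `U` is thick
and contains `U`, so it is everything. Hence reductions of all projective stalk complexes are
generated, and so are their retracts, which include every projective stalk complex over the fibre.
-/
lemma isClassicalTriangulatedGenerator_reduction {U : Kb Λ}
    (hU : (ObjectProperty.singleton U).IsClassicalTriangulatedGenerator) :
    (ObjectProperty.singleton ((reduction R Λ).obj U)).IsClassicalTriangulatedGenerator := by
  set Q := (ObjectProperty.singleton ((reduction R Λ).obj U)).triangEnvelope with hQ
  have hF : ∀ X, Q ((reduction R Λ).obj X) := by
    have : (Q.inverseImage (reduction R Λ)).IsStableUnderRetracts :=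
      ⟨fun ρ h => Q.prop_of_retract (ρ.map (reduction R Λ)) h⟩
    have : (ObjectProperty.singleton U).triangEnvelope ≤ Q.inverseImage (reduction R Λ) := by
      rw [ObjectProperty.triangEnvelope_le_iff, ObjectProperty.singleton_le_iff]
      exact ObjectProperty.le_triangEnvelope _ _ ((ObjectProperty.singleton_iff _ _).2 rfl)
    rw [hU] at this
    exact fun X => this X trivial
  refine eq_top_iff.2 fun X _ => prop_of_prop_single (Q := Q) (fun n P hP => ?_) X
  obtain ⟨N, hN, ⟨ρ⟩⟩ := exists_retract_reduceModule hP
  let e := (singleMapHomologicalComplex (reduceModule R Λ) (ComplexShape.up ℤ) n).app N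
  let ρ' := (ρ.map (single _ (ComplexShape.up ℤ) n)).trans e.symm.retract
  have hN' := isBoundedProj_single n hN
  exact Q.prop_of_retract (ρ'.kbOf (isBoundedProj_single n hP) hN'.reduce) (hF (kbOf _ hN'))

end Generation

/-! ### Two-term objects and retracts -/

section TwoTerm

variable {A : Type u} [Ring A]

lemma IsTwoTerm.exists_iso_kbOf {U : Kb A} (hU : IsTwoTerm U) :
    ∃ (C : CochainComplex (ModuleCat.{u} A) ℤ) (hC : IsBoundedProj A C),
      IsConcentrated C ∧ Nonempty (U ≅ kbOf C hC) := by
  obtain ⟨⟨X, hX⟩, e, h⟩ := hU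
  obtain ⟨C, rfl⟩ := X.quotient_obj_surjective
  exact ⟨C, hX, h, e⟩

lemma isTwoTerm_of_iso_kbOf {U : Kb A} {C : CochainComplex (ModuleCat.{u} A) ℤ}
    {hC : IsBoundedProj A C} (hC' : IsConcentrated C) (e : U ≅ kbOf C hC) : IsTwoTerm U :=
  ⟨kbOf C hC, ⟨e⟩, hC'⟩

lemma HomVanishes.of_retract {U V U' V' : Kb A} (ρ : Retract U' U) (ρ' : Retract V' V)
    (h : HomVanishes U V) : HomVanishes U' V' := by
  intro i hi f
  have h0 := h i hi (ρ.r ≫ f ≫ (shiftFunctor (Kb A) i).map ρ'.i)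
  have h1 : f = ρ.i ≫ (ρ.r ≫ f ≫ (shiftFunctor (Kb A) i).map ρ'.i) ≫
      (shiftFunctor (Kb A) i).map ρ'.r := by
    simp only [Category.assoc, Retract.retract_assoc]
    rw [← Functor.map_comp, ρ'.retract, CategoryTheory.Functor.map_id, Category.comp_id]
  rw [h1, h0, zero_comp, comp_zero]

end TwoTerm

/-! ### Reduction of two-term, indecomposable and basic objects -/

section Reduction

variable {R : Type u} [CommRing R] [IsLocalRing R] {Λ : Type u} [Ring Λ] [Algebra R Λ]

lemma IsTwoTerm.reduction {U : Kb Λ} (hU : IsTwoTerm U) : IsTwoTerm ((reduction R Λ).obj U) := by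
  obtain ⟨C, hC, hC', ⟨e⟩⟩ := hU.exists_iso_kbOf
  exact isTwoTerm_of_iso_kbOf (hC := hC.reduce) hC'.reduce ((SiltingReduction.reduction R Λ).mapIso e)

lemma HomVanishes.reduction {U V : Kb Λ} (hU : IsTwoTerm U) (hV : IsTwoTerm V)
    (h : HomVanishes U V) : HomVanishes ((reduction R Λ).obj U) ((reduction R Λ).obj V) := by
  obtain ⟨C, hC, hC', ⟨e⟩⟩ := hU.exists_iso_kbOf
  obtain ⟨D, hD, hD', ⟨e'⟩⟩ := hV.exists_iso_kbOf
  exact ((h.of_iso e e').reduction_kbOf hC hD hC' hD').of_iso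
    ((SiltingReduction.reduction R Λ).mapIso e).symm
    ((SiltingReduction.reduction R Λ).mapIso e').symm

lemma reduction_map_surjective_of_homVanishes [IsNoetherianRing R] {U V : Kb Λ} (hU : IsTwoTerm U)
    (hV : IsTwoTerm V) (h : HomVanishes U V)
    (g : (reduction R Λ).obj U ⟶ (reduction R Λ).obj V) : ∃ f, (reduction R Λ).map f = g := by
  obtain ⟨C, hC, hC', ⟨e⟩⟩ := hU.exists_iso_kbOf
  obtain ⟨D, hD, hD', ⟨e'⟩⟩ := hV.exists_iso_kbOf
  obtain ⟨f, hf⟩ := exists_reduction_map_eq_of_homVanishes (R := R) hC hD hC' hD' (h.of_iso e e')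
    ((reduction R Λ).map e.inv ≫ g ≫ (reduction R Λ).map e'.hom)
  refine ⟨e.hom ≫ f ≫ e'.inv, ?_⟩
  rw [Functor.map_comp, Functor.map_comp, hf, Category.assoc, Category.assoc,
    ← Functor.map_comp, e'.hom_inv_id, CategoryTheory.Functor.map_id, Category.comp_id,
    ← Functor.map_comp_assoc, e.hom_inv_id, CategoryTheory.Functor.map_id, Category.id_comp]

variable [IsNoetherianRing R] [Module.Finite R Λ]

lemma isIso_of_comp_eq_id_reduction {X Y : Kb Λ} (f : X ⟶ Y) (g : Y ⟶ X)
    (h₁ : (reduction R Λ).map (f ≫ g) = 𝟙 _) (h₂ : (reduction R Λ).map (g ≫ f) = 𝟙 _) :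
    IsIso f := by
  have := isIso_of_reduction_map_eq_id _ h₁
  have := isIso_of_reduction_map_eq_id _ h₂
  have : Mono f := mono_of_mono f g
  have : IsSplitEpi f := ⟨⟨{ section_ := inv (g ≫ f) ≫ g, id := by simp }⟩⟩
  exact isIso_of_mono_of_isSplitEpi f

/-- Two-term objects without `Hom(X, Y[1])` and `Hom(Y, X[1])` are isomorphic as soon as their
reductions are. -/
lemma nonempty_iso_of_reduction_iso {X Y : Kb Λ} (hX : IsTwoTerm X) (hY : IsTwoTerm Y)
    (hXY : HomVanishes X Y) (hYX : HomVanishes Y X)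
    (e : (reduction R Λ).obj X ≅ (reduction R Λ).obj Y) : Nonempty (X ≅ Y) := by
  obtain ⟨f, hf⟩ := reduction_map_surjective_of_homVanishes hX hY hXY e.hom
  obtain ⟨g, hg⟩ := reduction_map_surjective_of_homVanishes hY hX hYX e.inv
  have := isIso_of_comp_eq_id_reduction f g (by rw [Functor.map_comp, hf, hg, e.hom_inv_id])
    (by rw [Functor.map_comp, hf, hg, e.inv_hom_id])
  exact ⟨asIso f⟩

/-- The projection onto a summand is idempotent, and an idempotent unit equals 1; so one of the two
complementary projections is the identity and the other summand is zero. -/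
lemma indecomposable_of_isUnit_or {𝒞 : Type*} [Category 𝒞] [Preadditive 𝒞]
    [HasBinaryBiproducts 𝒞] {X : 𝒞} (h0 : ¬ IsZero X)
    (h : ∀ f : End X, IsUnit f ∨ IsUnit (1 - f)) : Indecomposable X := by
  refine ⟨h0, fun Y Z e => ?_⟩
  let f : End X := e.hom ≫ biprod.fst ≫ biprod.inl ≫ e.inv
  have hf : IsIdempotentElem f := by
    change (e.hom ≫ biprod.fst ≫ biprod.inl ≫ e.inv) ≫ e.hom ≫ biprod.fst ≫ biprod.inl ≫ e.inv = _
    simp [f]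
  rcases h f with hu | hu
  · right
    have h1 : f = 1 := (IsIdempotentElem.iff_eq_one_of_isUnit hu).1 hf
    have h2 : biprod.inr ≫ e.inv ≫ f ≫ e.hom ≫ biprod.snd = 𝟙 Z := by
      rw [h1]
      change biprod.inr ≫ e.inv ≫ 𝟙 X ≫ e.hom ≫ biprod.snd = 𝟙 Z
      simp
    rw [IsZero.iff_id_eq_zero, ← h2]
    simp [f]
  · left
    have h1 : 1 - f = 1 := (IsIdempotentElem.iff_eq_one_of_isUnit hu).1 hf.one_sub
    have h1' : f = 0 := by simpa using h1
    have h2 : biprod.inl ≫ e.inv ≫ f ≫ e.hom ≫ biprod.fst = 𝟙 Y := by simp [f]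
    rw [IsZero.iff_id_eq_zero, ← h2, h1']
    change biprod.inl ≫ e.inv ≫ (0 : X ⟶ X) ≫ e.hom ≫ biprod.fst = 0
    simp

variable [IsAdicComplete (IsLocalRing.maximalIdeal R) R]

lemma IsTwoTerm.of_retract (R : Type u) [CommRing R] [IsLocalRing R] [Algebra R Λ]
    [IsNoetherianRing R] [Module.Finite R Λ] [IsAdicComplete (IsLocalRing.maximalIdeal R) R]
    {X U : Kb Λ} (ρ : Retract X U) (hU : IsTwoTerm U) : IsTwoTerm X := by
  obtain ⟨C, hC, hC', ⟨e⟩⟩ := hU.exists_iso_kbOf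
  obtain ⟨D, hD, hD', ⟨e'⟩⟩ := exists_iso_kbOf_of_retract R hC hC' (ρ.i ≫ e.hom) (e.inv ≫ ρ.r)
    (by simp)
  exact isTwoTerm_of_iso_kbOf hD' e'

/-- Since `Hom(X, X[1]) = 0`, the endomorphism ring of the reduction is a quotient of `End X`, so
the unit dichotomy passes to it. -/
lemma indecomposable_reduction {X : Kb Λ} (hX : Indecomposable X) (hX₂ : IsTwoTerm X)
    (h : HomVanishes X X) : Indecomposable ((reduction R Λ).obj X) := by
  refine indecomposable_of_isUnit_or (fun h0 => hX.1 ?_) fun g => ?_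
  -- If the reduction were zero, the zero endomorphism of `X` would reduce to the identity, hence be
  -- invertible by Nakayama.
  · have : IsIso (0 : X ⟶ X) := isIso_of_reduction_map_eq_id (R := R) _ (h0.eq_of_src _ _)
    rw [IsZero.iff_id_eq_zero, ← IsIso.hom_inv_id (0 : X ⟶ X), zero_comp]
  · obtain ⟨f, rfl⟩ : ∃ f : End X, (reduction R Λ).map f = g :=
      reduction_map_surjective_of_homVanishes hX₂ hX₂ h g
    let π : End X →* End ((reduction R Λ).obj X) := (reduction R Λ).mapEnd X
    rcases isUnit_or_isUnit_one_sub_of_indecomposable R hX f with hf | hf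
    · exact Or.inl (hf.map π)
    · right
      have := hf.map π
      have h1 : π (1 - f) = 1 - π f := by
        refine ((reduction R Λ).map_sub (f := 𝟙 X) (g := f)).trans ?_
        rw [CategoryTheory.Functor.map_id]
        rfl
      rwa [h1] at this

/-- The summands of `U` are retracts of it, so they inherit the two-term property and mutual Hom
vanishing. Reduction therefore keeps each one indecomposable and reflects isomorphisms among them.
-/
lemma IsBasic.reduction {U : Kb Λ} (hU : IsBasic U) (hU₂ : IsTwoTerm U) (h : HomVanishes U U) :
    IsBasic ((reduction R Λ).obj U) := by
  obtain ⟨n, X, hX, hne, ⟨e⟩⟩ := hU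
  have ρ : ∀ j, Retract (X j) U := fun j =>
    { i := biproduct.ι X j ≫ e.inv
      r := e.hom ≫ biproduct.π X j }
  have h₂ : ∀ j, IsTwoTerm (X j) := fun j => hU₂.of_retract R (ρ j)
  have hv : ∀ j k, HomVanishes (X j) (X k) := fun j k => h.of_retract (ρ j) (ρ k)
  refine ⟨n, fun j => (SiltingReduction.reduction R Λ).obj (X j),
    fun j => indecomposable_reduction (hX j) (h₂ j) (hv j j), ?_, ?_⟩
  · rintro j k ⟨f⟩
    exact hne j k (nonempty_iso_of_reduction_iso (h₂ j) (h₂ k) (hv j k) (hv k j) f)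
  · exact ⟨(SiltingReduction.reduction R Λ).mapIso e ≪≫
      (SiltingReduction.reduction R Λ).mapBiproduct X⟩

end Reduction

end SiltingReduction

end

theorem proposition3p4 (R : Type u) [CommRing R] [IsDomain R] [IsLocalRing R] [IsNoetherianRing R]
    [IsIntegrallyClosed R] [IsAdicComplete (IsLocalRing.maximalIdeal R) R]
    (hdim : ringKrullDim R = 3) (hR : SiltingReduction.IsGorensteinLocal R)
    (Λ : Type u) [Ring Λ] [Algebra R Λ] (hΛ : SiltingReduction.IsNCCR R Λ) :
    Set.MapsTo (SiltingReduction.reductionClass R Λ) (SiltingReduction.silt Λ)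
        (SiltingReduction.silt (SiltingReduction.Fibre R Λ)) ∧
      ∀ x ∈ SiltingReduction.silt Λ, ∀ y ∈ SiltingReduction.silt Λ,
        SiltingReduction.siltLE x y →
          SiltingReduction.siltLE (SiltingReduction.reductionClass R Λ x)
            (SiltingReduction.reductionClass R Λ y) := by
  -- Finiteness of `Λ` over `R` feeds both Nakayama and the Fitting idempotents.
  have := hΛ.maximalCohenMacaulay.finite
  refine ⟨?_, ?_⟩
  · rintro _ ⟨U, hb, h₂, hs, rfl⟩
    exact ⟨(SiltingReduction.reduction R Λ).obj U, hb.reduction h₂ hs.preSilting, h₂.reduction,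
      ⟨hs.preSilting.reduction h₂ h₂,
        SiltingReduction.isClassicalTriangulatedGenerator_reduction hs.generates⟩, rfl⟩
  · rintro _ ⟨U, -, hU, -, rfl⟩ _ ⟨V, -, hV, -, rfl⟩ h
    exact SiltingReduction.HomVanishes.reduction hU hV h
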